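/- Let $-\infty\le\alpha<\beta\le\infty$, let $U=\{s\in\mathbb{C}:\alpha<\operatorname{Re}s<\beta\}$, and let $f$ be almost periodic in $U$; that is, $f$ is analytic in $U$ and for all real $a\le b$ with $\alpha<a\le b<\beta$ and every $\varepsilon>0$ there is $l>0$ such that every open interval of length $l$ contains a number $\tau$ with $|f(s+i\tau)-f(s)|\le\varepsilon$ for all $s$ with $a\le\operatorname{Re}s\le b$. For $\lambda\in\mathbb{R}$ let $$a(\lambda)=\lim_{T\to\infty}\frac1{2T}\int_{-T}^{T}f(\sigma+it)\,e^{-\lambda(\sigma+it)}\,dt\qquad(\alpha<\sigma<\beta),$$ a limit that exists and does not depend on $\sigma$, and let $\Lambda=\{\lambda\in\mathbb{R}:a(\lambda)\ne0\}$ be the set of Fourier exponents of $f$. Suppose that $\Lambda$ has at least three elements and is linearly independent over $\mathbb{Q}$. Let $$R_f=\overline{\{\operatorname{Re}s: s\in U,\ f(s)=0\}}\cap(\alpha,\beta),$$ and let $\sigma_0\in(\alpha,\beta)$ be a boundary point of $R_f$. Then $\sum_{\lambda\in\Lambda}|a(\lambda)|e^{\sigma_0\lambda}<\infty$, the inequalities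 $$|a(\lambda)|\,e^{\sigma_0\lambda}\ \le\sum_{\mu\in\Lambda,\ \mu\ne\lambda}|a(\mu)|\,e^{\sigma_0\mu}\qquad(\lambda\in\Lambda)$$ all hold, and exactly one of them is an equality. -/

import Mathlib

open Filter Topology

/-- The open vertical strip `{s : α < Re s < β}`, with `-∞ ≤ α`, `β ≤ ∞`. -/
def verticalStrip (α β : EReal) : Set ℂ :=
  {s | α < (s.re : EReal) ∧ (s.re : EReal) < β}

/-- `f` is (Bohr) almost periodic in the strip `α < Re s < β`: it is analytic there and, in every
reduced strip `a ≤ Re s ≤ b` (with `α < a ≤ b < β`), for every `ε > 0` the set of its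
`ε`-translation numbers is relatively dense. -/
def AlmostPeriodicInStrip (f : ℂ → ℂ) (α β : EReal) : Prop :=
  DifferentiableOn ℂ f (verticalStrip α β) ∧
    ∀ a b : ℝ, α < (a : EReal) → a ≤ b → (b : EReal) < β →
      ∀ ε : ℝ, 0 < ε → ∃ l : ℝ, 0 < l ∧ ∀ t₀ : ℝ, ∃ τ ∈ Set.Ioo t₀ (t₀ + l),
        ∀ s : ℂ, a ≤ s.re → s.re ≤ b → ‖f (s + Complex.I * (τ : ℂ)) - f s‖ ≤ ε

/-- `c` is the coefficient of `e^{μ s}` in the Dirichlet series of `f` in the strip: on every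
vertical line `Re s = σ` of the strip, the mean value of `f s * e^{-μ s}` exists and equals `c`. -/
def IsDirichletCoeff (f : ℂ → ℂ) (α β : EReal) (μ : ℝ) (c : ℂ) : Prop :=
  ∀ σ : ℝ, α < (σ : EReal) → (σ : EReal) < β →
    Tendsto
      (fun T : ℝ => ((2 * T : ℝ) : ℂ)⁻¹ *
        ∫ t in (-T)..T, f ((σ : ℂ) + Complex.I * (t : ℂ)) *
          Complex.exp (-((μ : ℂ) * ((σ : ℂ) + Complex.I * (t : ℂ)))))
      atTop (𝓝 c)

open Classical in
/-- The coefficient of `e^{μ s}` in the Dirichlet series of `f` in the strip `α < Re s < β`.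
For an almost periodic `f` the mean values always exist and do not depend on the line, so that
the default value `0` is not used. -/
noncomputable def dirichletCoeff (f : ℂ → ℂ) (α β : EReal) (μ : ℝ) : ℂ :=
  if h : ∃ c : ℂ, IsDirichletCoeff f α β μ c then h.choose else 0

/-- The set of Fourier exponents of `f` in the strip `α < Re s < β`. -/
def fourierExponents (f : ℂ → ℂ) (α β : EReal) : Set ℝ :=
  {μ | dirichletCoeff f α β μ ≠ 0}

/-- The size `|a_μ| e^{σ μ}` of the term with exponent `μ` of the Dirichlet series, at abscissa
`σ`. -/
noncomputable def termSize (f : ℂ → ℂ) (α β : EReal) (σ μ : ℝ) : ℝ :=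
  ‖dirichletCoeff f α β μ‖ * Real.exp (σ * μ)

/-- The set `R_f`: closure (in `ℝ`) of the set of the real parts of the zeros of `f` in the strip,
intersected with `(α, β)`. -/
def zeroProjections (f : ℂ → ℂ) (α β : EReal) : Set ℝ :=
  closure {σ : ℝ | ∃ s ∈ verticalStrip α β, f s = 0 ∧ s.re = σ} ∩
    {σ : ℝ | α < (σ : EReal) ∧ (σ : EReal) < β}

/-! Write `T_λ(σ) = |a(λ)| e^{σλ}`. The heart of the matter is that `R_f` consists exactly of those
`σ` in `(α, β)` for which the polygon inequalities hold, that is, no `T_λ(σ)` exceeds the sum of the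
others.

Independence of the exponents makes the Dirichlet series converge absolutely. Testing `f` on a
vertical line against a Riesz product gives Bohr's inequality `∑ T_λ ≤ 2 sup |f|`
(`sum_norm_coeff_le`, `summable_termSize`), and the uniqueness theorem for almost periodic functions
(`eq_zero_of_fourier_zero`) shows that the series represents `f` (`eq_tsum_dirichlet`).

At a zero of `f`, each term is minus the sum of the others, which gives the polygon inequalities on
`R_f` by continuity. Conversely, if they hold at `σ`, the sides `T_λ(σ)` can be turned so as to
close up (`exists_phases`). By Kronecker's theorem (`exists_realChar_near`), vertical translates of
`f` approach the series with its coefficients turned accordingly. That series vanishes at `σ`, so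
Hurwitz's theorem produces zeros of `f` with real parts near `σ` (`mem_closure_zeros_of_le`).

At a boundary point the inequalities hold. Were all of them strict, they would persist nearby,
because only finitely many terms are large, and the point would be interior. Two equalities would
make two terms exhaust the whole sum, leaving nothing for a third exponent. -/

/-! ### Almost periodic functions on the real line -/

/-- A function on `ℝ` is (uniformly) almost periodic if it is continuous and its translates form
a totally bounded family for the supremum distance. -/
def AlmostPeriodic (h : ℝ → ℂ) : Prop :=
  Continuous h ∧ ∀ ε : ℝ, 0 < ε → ∃ (n : ℕ) (c : ℝ → Fin n), ∀ τ τ' : ℝ, c τ = c τ' →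
    ∀ t : ℝ, ‖h (t + τ) - h (t + τ')‖ ≤ ε

/-- The character `t ↦ e^{iλt}` of the real line. -/
noncomputable def realChar (lam t : ℝ) : ℂ := Complex.exp (Complex.I * ((lam * t : ℝ) : ℂ))

theorem norm_realChar (lam t : ℝ) : ‖realChar lam t‖ = 1 := by
  unfold realChar
  rw [mul_comm]
  exact Complex.norm_exp_ofReal_mul_I _

theorem realChar_add_right (lam s t : ℝ) :
    realChar lam (s + t) = realChar lam s * realChar lam t := by
  unfold realChar
  rw [← Complex.exp_add]
  congr 1
  push_cast
  ring

theorem realChar_add_left (lam mu t : ℝ) :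
    realChar (lam + mu) t = realChar lam t * realChar mu t := by
  unfold realChar
  rw [← Complex.exp_add]
  congr 1
  push_cast
  ring

@[simp] theorem realChar_zero_left (t : ℝ) : realChar 0 t = 1 := by
  simp [realChar]

@[simp] theorem realChar_zero_right (lam : ℝ) : realChar lam 0 = 1 := by
  simp [realChar]

theorem continuous_realChar (lam : ℝ) : Continuous (realChar lam) := by
  unfold realChar
  fun_prop

theorem norm_realChar_sub_one_le (lam t : ℝ) : ‖realChar lam t - 1‖ ≤ |lam * t| := by
  unfold realChar
  exact Real.norm_exp_I_mul_ofReal_sub_one_le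

namespace AlmostPeriodic

variable {h g : ℝ → ℂ}

theorem exists_net (hh : AlmostPeriodic h) {ε : ℝ} (hε : 0 < ε) :
    ∃ S : Finset ℝ, S.Nonempty ∧ ∀ τ, ∃ r ∈ S, ∀ t, ‖h (t + τ) - h (t + r)‖ ≤ ε := by
  classical
  obtain ⟨n, c, hc⟩ := hh.2 ε hε
  -- A label carried by no translate is sent to `0`, which only adds a harmless point to the net.
  let rep : Fin n → ℝ := fun i => if hi : ∃ τ, c τ = i then hi.choose else 0
  have hrep : ∀ τ, c (rep (c τ)) = c τ := by
    intro τ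
    have hi : ∃ τ', c τ' = c τ := ⟨τ, rfl⟩
    simp only [rep, dif_pos hi]
    exact hi.choose_spec
  refine ⟨Finset.univ.image rep, ⟨rep (c 0), by simp⟩, fun τ => ⟨rep (c τ), by simp, ?_⟩⟩
  exact fun t => hc _ _ (hrep τ).symm t

theorem bounded (hh : AlmostPeriodic h) : ∃ C : ℝ, 0 < C ∧ ∀ t, ‖h t‖ ≤ C := by
  obtain ⟨S, -, hS⟩ := hh.exists_net one_pos
  refine ⟨1 + ∑ r ∈ S, ‖h r‖, by positivity, fun t => ?_⟩
  obtain ⟨r, hr, hrt⟩ := hS t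
  have h1 := hrt 0
  simp only [zero_add] at h1
  have h2 : ‖h r‖ ≤ ∑ r ∈ S, ‖h r‖ :=
    Finset.single_le_sum (f := fun r => ‖h r‖) (fun _ _ => norm_nonneg _) hr
  have h3 : ‖h t‖ ≤ ‖h t - h r‖ + ‖h r‖ := by
    simpa using norm_add_le (h t - h r) (h r)
  linarith

theorem uniform_continuous (hh : AlmostPeriodic h) {ε : ℝ} (hε : 0 < ε) :
    ∃ δ : ℝ, 0 < δ ∧ ∀ t u : ℝ, |u| ≤ δ → ‖h (t + u) - h t‖ ≤ ε := by
  obtain ⟨S, hSne, hS⟩ := hh.exists_net (ε := ε / 3) (by positivity)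
  have h1 : ∀ r : ℝ, ∃ δ : ℝ, 0 < δ ∧ ∀ u, |u| ≤ δ → ‖h (r + u) - h r‖ ≤ ε / 3 := by
    intro r
    have := Metric.continuous_iff.1 hh.1 r (ε / 3) (by positivity)
    obtain ⟨δ, hδ, H⟩ := this
    refine ⟨δ / 2, by positivity, fun u hu => ?_⟩
    have := H (r + u) (by simp; linarith)
    rw [dist_eq_norm] at this
    exact this.le
  choose d hd hd' using h1
  refine ⟨S.inf' hSne d, ?_, fun t u hu => ?_⟩
  · rw [Finset.lt_inf'_iff]
    exact fun r _ => hd r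
  · obtain ⟨r, hr, hrt⟩ := hS t
    have e1 := hrt u
    have e2 := hrt 0
    have e3 := hd' r u (hu.trans (Finset.inf'_le d hr))
    simp only [zero_add] at e2
    rw [add_comm u t, add_comm u r] at e1
    have : h (t + u) - h t = (h (t + u) - h (r + u)) + (h (r + u) - h r) - (h t - h r) := by ring
    rw [this]
    calc _ ≤ ‖h (t + u) - h (r + u)‖ + ‖h (r + u) - h r‖ + ‖h t - h r‖ :=
          (norm_sub_le _ _).trans (add_le_add_left (norm_add_le _ _) _)
      _ ≤ ε := by linarith

/-- Pairs of labels serve as labels for `k`. This is the advantage of the finite-label form of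
almost periodicity: no common translation numbers of `h` and `g` have to be found. -/
theorem of_labels₂ (hh : AlmostPeriodic h) (hg : AlmostPeriodic g) {k : ℝ → ℂ}
    (hk : Continuous k)
    (H : ∀ ε : ℝ, 0 < ε → ∃ δ : ℝ, 0 < δ ∧ ∀ t t' : ℝ, ‖h t - h t'‖ ≤ δ → ‖g t - g t'‖ ≤ δ →
      ‖k t - k t'‖ ≤ ε) : AlmostPeriodic k := by
  refine ⟨hk, fun ε hε => ?_⟩
  obtain ⟨δ, hδ, hδ'⟩ := H ε hε
  obtain ⟨n, c, hc⟩ := hh.2 δ hδ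
  obtain ⟨m, d, hd⟩ := hg.2 δ hδ
  refine ⟨n * m, fun τ => finProdFinEquiv (c τ, d τ), fun τ τ' hτ t => ?_⟩
  have := finProdFinEquiv.injective hτ
  rw [Prod.mk.injEq] at this
  exact hδ' _ _ (hc _ _ this.1 t) (hd _ _ this.2 t)

theorem mul (hh : AlmostPeriodic h) (hg : AlmostPeriodic g) :
    AlmostPeriodic (fun t => h t * g t) := by
  obtain ⟨C, hC, hC'⟩ := hh.bounded
  obtain ⟨D, hD, hD'⟩ := hg.bounded
  refine of_labels₂ hh hg (hh.1.mul hg.1) fun ε hε => ⟨ε / (C + D), by positivity, ?_⟩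
  intro t t' h1 h2
  have : h t * g t - h t' * g t' = h t * (g t - g t') + (h t - h t') * g t' := by ring
  rw [this]
  calc _ ≤ ‖h t‖ * ‖g t - g t'‖ + ‖h t - h t'‖ * ‖g t'‖ := by
        refine (norm_add_le _ _).trans ?_
        rw [norm_mul, norm_mul]
    _ ≤ C * (ε / (C + D)) + (ε / (C + D)) * D := by
        gcongr
        · exact hC' t
        · exact hD' t'
    _ = ε := by field_simp

theorem sub (hh : AlmostPeriodic h) (hg : AlmostPeriodic g) :
    AlmostPeriodic (fun t => h t - g t) := by
  refine of_labels₂ hh hg (hh.1.sub hg.1) fun ε hε => ⟨ε / 2, by positivity, ?_⟩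
  intro t t' h1 h2
  have : h t - g t - (h t' - g t') = (h t - h t') - (g t - g t') := by ring
  rw [this]
  exact (norm_sub_le _ _).trans (by linarith)

theorem star (hh : AlmostPeriodic h) : AlmostPeriodic (fun t => (starRingEnd ℂ) (h t)) := by
  refine of_labels₂ hh hh (Complex.continuous_conj.comp hh.1) fun ε hε => ⟨ε, hε, ?_⟩
  intro t t' h1 _
  rw [← map_sub, RCLike.norm_conj]
  exact h1

/-- Passage from Bohr's definition to total boundedness. Removing a translation number `p τ` from
`τ` leaves a remainder in `[0, l]`, and by uniform continuity it is enough to know that remainder up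
to `δ`. The label is thus its cell in a grid of mesh `δ`. -/
theorem of_relatively_dense (hh : Continuous h)
    (H : ∀ ε : ℝ, 0 < ε → ∃ l : ℝ, 0 < l ∧ ∀ t₀ : ℝ, ∃ τ ∈ Set.Ioo t₀ (t₀ + l),
      ∀ t, ‖h (t + τ) - h t‖ ≤ ε) : AlmostPeriodic h := by
  have huc : ∀ ε : ℝ, 0 < ε → ∃ δ : ℝ, 0 < δ ∧ ∀ t u : ℝ, |u| ≤ δ → ‖h (t + u) - h t‖ ≤ ε := by
    intro ε hε
    obtain ⟨l, hl, hl'⟩ := H (ε / 3) (by positivity)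
    -- A translation number moves `t` into `(0, l)`; the margin `1` on either side leaves room for
    -- `u`.
    have := (isCompact_Icc (a := (-1 : ℝ)) (b := l + 1)).uniformContinuousOn_of_continuous
      hh.continuousOn
    rw [Metric.uniformContinuousOn_iff] at this
    obtain ⟨δ, hδ, hδ'⟩ := this (ε / 3) (by positivity)
    refine ⟨min (δ / 2) 1, by positivity, fun t u hu => ?_⟩
    obtain ⟨τ, hτ, hτ'⟩ := hl' (-t)
    have hu1 := hu.trans (min_le_left _ _)
    have hu2 := abs_le.1 (hu.trans (min_le_right _ _))
    have e1 := hτ' (t + u)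
    have e2 := hτ' t
    have e3 := hδ' (t + u + τ) ⟨by linarith [hτ.1], by linarith [hτ.2]⟩ (t + τ)
      ⟨by linarith [hτ.1], by linarith [hτ.2]⟩ (by
        rw [Real.dist_eq]
        have : t + u + τ - (t + τ) = u := by ring
        rw [this]
        linarith)
    rw [dist_eq_norm] at e3
    have : h (t + u) - h t = (h (t + u + τ) - h (t + τ)) - (h (t + u + τ) - h (t + u)) +
      (h (t + τ) - h t) := by ring
    rw [this]
    calc _ ≤ ‖h (t + u + τ) - h (t + τ)‖ + ‖h (t + u + τ) - h (t + u)‖ + ‖h (t + τ) - h t‖ :=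
          (norm_add_le _ _).trans (add_le_add_left (norm_sub_le _ _) _)
      _ ≤ ε := by linarith
  refine ⟨hh, fun ε hε => ?_⟩
  obtain ⟨δ, hδ, hδ'⟩ := huc (ε / 3) (by positivity)
  obtain ⟨l, hl, hl'⟩ := H (ε / 3) (by positivity)
  choose p hp hp' using fun τ : ℝ => hl' (τ - l)
  have hr0 : ∀ τ, 0 ≤ τ - p τ := fun τ => by linarith [(hp τ).2]
  have hrl : ∀ τ, τ - p τ ≤ l := fun τ => by linarith [(hp τ).1]
  have hlt : ∀ τ, ⌊(τ - p τ) / δ⌋₊ < ⌊l / δ⌋₊ + 1 := fun τ =>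
    Nat.lt_succ_of_le (Nat.floor_mono (by gcongr; exact hrl τ))
  refine ⟨⌊l / δ⌋₊ + 1, fun τ => ⟨_, hlt τ⟩, fun τ τ' hττ t => ?_⟩
  have hfl : ⌊(τ - p τ) / δ⌋₊ = ⌊(τ' - p τ') / δ⌋₊ := by simpa using hττ
  have hclose : |(τ - p τ) - (τ' - p τ')| ≤ δ := by
    have a1 := Nat.floor_le (div_nonneg (hr0 τ) hδ.le)
    have a2 := Nat.lt_floor_add_one ((τ - p τ) / δ)
    have b1 := Nat.floor_le (div_nonneg (hr0 τ') hδ.le)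
    have b2 := Nat.lt_floor_add_one ((τ' - p τ') / δ)
    rw [hfl] at a1 a2
    have hc : |(τ - p τ) / δ - (τ' - p τ') / δ| ≤ 1 := by
      rw [abs_le]; constructor <;> linarith
    rwa [← sub_div, abs_div, abs_of_pos hδ, div_le_one hδ] at hc
  have e1 := hp' τ (t + (τ - p τ))
  have e2 := hp' τ' (t + (τ' - p τ'))
  have e3 := hδ' (t + (τ' - p τ')) ((τ - p τ) - (τ' - p τ')) hclose
  rw [show t + (τ - p τ) + p τ = t + τ by ring] at e1
  rw [show t + (τ' - p τ') + p τ' = t + τ' by ring] at e2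
  rw [show t + (τ' - p τ') + (τ - p τ - (τ' - p τ')) = t + (τ - p τ) by ring] at e3
  have : h (t + τ) - h (t + τ') = (h (t + τ) - h (t + (τ - p τ))) -
    (h (t + τ') - h (t + (τ' - p τ'))) + (h (t + (τ - p τ)) - h (t + (τ' - p τ'))) := by ring
  rw [this]
  calc _ ≤ ‖h (t + τ) - h (t + (τ - p τ))‖ + ‖h (t + τ') - h (t + (τ' - p τ'))‖ +
        ‖h (t + (τ - p τ)) - h (t + (τ' - p τ'))‖ :=
        (norm_add_le _ _).trans (add_le_add_left (norm_sub_le _ _) _)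
    _ ≤ ε := by linarith

theorem of_periodic (hh : Continuous h) {P : ℝ} (hP : 0 < P) (H : ∀ t, h (t + P) = h t) :
    AlmostPeriodic h := by
  have hper : Function.Periodic h P := H
  refine of_relatively_dense hh fun ε hε => ⟨2 * P, by positivity, fun t₀ => ?_⟩
  refine ⟨(⌊t₀ / P⌋ + 1 : ℤ) * P, ⟨?_, ?_⟩, fun t => ?_⟩
  · have := Int.lt_floor_add_one (t₀ / P)
    rw [div_lt_iff₀ hP] at this
    push_cast
    exact this
  · have := Int.floor_le (t₀ / P)
    rw [le_div_iff₀ hP] at this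
    push_cast
    linarith
  · rw [hper.int_mul _ t]
    simpa using hε.le

theorem const (z : ℂ) : AlmostPeriodic (fun _ => z) :=
  of_periodic continuous_const one_pos fun _ => rfl

theorem char (lam : ℝ) : AlmostPeriodic (realChar lam) := by
  rcases eq_or_ne lam 0 with rfl | hl
  · simpa [funext (realChar_zero_left)] using const 1
  · refine of_periodic (P := 2 * Real.pi / |lam|) (continuous_realChar lam)
      (by have := Real.pi_pos; positivity) fun t => ?_
    rw [realChar_add_right]
    suffices realChar lam (2 * Real.pi / |lam|) = 1 by rw [this, mul_one]
    unfold realChar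
    rcases abs_cases lam with ⟨h1, _⟩ | ⟨h1, _⟩
    · rw [h1, mul_div_cancel₀ _ hl, mul_comm]
      push_cast
      exact Complex.exp_two_pi_mul_I
    · rw [h1, div_neg, mul_neg, mul_div_cancel₀ _ hl, Complex.ofReal_neg, mul_neg, Complex.exp_neg,
        mul_comm]
      push_cast
      rw [Complex.exp_two_pi_mul_I, inv_one]

/-- Pigeonhole: two multiples of `Q` carry the same label, and their difference is a translation
number of size at least `Q`. -/
theorem exists_large_translation (hh : AlmostPeriodic h) {ε : ℝ} (hε : 0 < ε) (R : ℝ) :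
    ∃ τ : ℝ, R ≤ τ ∧ 0 < τ ∧ ∀ t, ‖h (t + τ) - h t‖ ≤ ε := by
  obtain ⟨n, c, hc⟩ := hh.2 ε hε
  set Q := max R 1
  have hQ : 0 < Q := lt_of_lt_of_le one_pos (le_max_right _ _)
  obtain ⟨j, k, hjk, he⟩ := Finite.exists_ne_map_eq_of_infinite (fun k : ℕ => c (k * Q))
  wlog hlt : j < k generalizing j k
  · exact this k j hjk.symm he.symm (lt_of_le_of_ne (not_lt.1 hlt) hjk.symm)
  have h1 : (1 : ℝ) ≤ (k : ℝ) - j := by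
    have : (j : ℝ) + 1 ≤ k := by exact_mod_cast hlt
    linarith
  have h2 : Q ≤ ((k : ℝ) - j) * Q := by nlinarith
  refine ⟨((k : ℝ) - j) * Q, (le_max_left _ _).trans h2, hQ.trans_le h2, fun t => ?_⟩
  have := hc _ _ he.symm (t - j * Q)
  rwa [show t - j * Q + k * Q = t + ((k : ℝ) - j) * Q by ring,
    show t - j * Q + j * Q = t by ring] at this

end AlmostPeriodic

/-! ### Mean values -/

theorem intervalIntegral_swap_of_continuous {F : ℝ → ℝ → ℂ} (hF : Continuous (Function.uncurry F))
    {a b c d : ℝ} (hab : a ≤ b) (hcd : c ≤ d) :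
    ∫ x in a..b, ∫ y in c..d, F x y = ∫ y in c..d, ∫ x in a..b, F x y := by
  simp only [intervalIntegral.integral_of_le hab, intervalIntegral.integral_of_le hcd]
  apply MeasureTheory.integral_integral_swap
  rw [MeasureTheory.Measure.prod_restrict]
  have : MeasureTheory.IntegrableOn (Function.uncurry F) (Set.Icc a b ×ˢ Set.Icc c d)
      (MeasureTheory.volume.prod MeasureTheory.volume) :=
    hF.continuousOn.integrableOn_compact (isCompact_Icc.prod isCompact_Icc)
  exact this.mono_set (Set.prod_mono Set.Ioc_subset_Icc_self Set.Ioc_subset_Icc_self)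

theorem norm_integral_translate_sub_le {E : Type*} [NormedAddCommGroup E] [NormedSpace ℝ E]
    {u : ℝ → E} (hu : Continuous u) {C : ℝ}
    (hC : ∀ t, ‖u t‖ ≤ C) (x T : ℝ) :
    ‖(∫ t in (0 : ℝ)..T, u (x + t)) - ∫ t in (0 : ℝ)..T, u t‖ ≤ 2 * C * |x| := by
  rw [intervalIntegral.integral_comp_add_left (fun t => u t) x,
    intervalIntegral.integral_interval_sub_interval_comm' (hu.intervalIntegrable _ _)
      (hu.intervalIntegrable _ _) (hu.intervalIntegrable _ _)]
  have h1 : ‖∫ t in T..(x + T), u t‖ ≤ C * |x + T - T| :=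
    intervalIntegral.norm_integral_le_of_norm_le_const fun t _ => hC t
  have h2 : ‖∫ t in (0 : ℝ)..(x + 0), u t‖ ≤ C * |x + 0 - 0| :=
    intervalIntegral.norm_integral_le_of_norm_le_const fun t _ => hC t
  simp only [add_sub_cancel_right, add_zero, sub_zero] at h1 h2
  rw [add_zero]
  exact (norm_sub_le _ _).trans (by linarith)

theorem norm_integral_sub_le_of_norm_sub_le {u v : ℝ → ℂ} (hu : Continuous u) (hv : Continuous v)
    {ε T : ℝ} (hT : 0 ≤ T) (H : ∀ t, ‖u t - v t‖ ≤ ε) :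
    ‖(∫ t in (0 : ℝ)..T, u t) - ∫ t in (0 : ℝ)..T, v t‖ ≤ ε * T := by
  rw [← intervalIntegral.integral_sub (hu.intervalIntegrable _ _) (hv.intervalIntegrable _ _)]
  have := intervalIntegral.norm_integral_le_of_norm_le_const (a := 0) (b := T)
    (f := fun t => u t - v t) fun t _ => H t
  rwa [sub_zero, abs_of_nonneg hT] at this

/-- `m` is the mean value of `h`, uniformly over all translates. -/
def HasMean (h : ℝ → ℂ) (m : ℂ) : Prop :=
  ∀ ε : ℝ, 0 < ε → ∃ T₀ : ℝ, 0 < T₀ ∧ ∀ T : ℝ, T₀ ≤ T → ∀ x : ℝ,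
    ‖(∫ t in (0 : ℝ)..T, h (x + t)) - T * m‖ ≤ ε * T

namespace AlmostPeriodic

variable {h : ℝ → ℂ}

/-- The shift `x` may be replaced by a member `r` of a finite net. Shifting by `r` changes the
integral only by two end pieces of length `|r|`, which are bounded independently of `x` and
negligible against `T`. -/
theorem integral_translate_close (hh : AlmostPeriodic h) {ε : ℝ} (hε : 0 < ε) :
    ∃ T₀ : ℝ, 0 < T₀ ∧ ∀ T : ℝ, T₀ ≤ T → ∀ x : ℝ,
      ‖(∫ t in (0 : ℝ)..T, h (x + t)) - ∫ t in (0 : ℝ)..T, h t‖ ≤ ε * T := by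
  obtain ⟨S, -, hS⟩ := hh.exists_net (half_pos hε)
  obtain ⟨C, hC, hC'⟩ := hh.bounded
  have hs : 0 ≤ ∑ r ∈ S, |r| := Finset.sum_nonneg fun _ _ => abs_nonneg _
  refine ⟨4 * C * (1 + ∑ r ∈ S, |r|) / ε, by positivity, fun T hT x => ?_⟩
  obtain ⟨r, hr, hrt⟩ := hS x
  have hr' : |r| ≤ ∑ r ∈ S, |r| :=
    Finset.single_le_sum (f := fun r : ℝ => |r|) (fun _ _ => abs_nonneg _) hr
  have hT0 : 0 ≤ T := le_trans (by positivity) hT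
  rw [div_le_iff₀ hε] at hT
  have e1 := norm_integral_sub_le_of_norm_sub_le (u := fun t => h (x + t))
    (v := fun t => h (r + t)) (hh.1.comp (continuous_const_add x))
    (hh.1.comp (continuous_const_add r)) hT0 (fun t => by
      rw [add_comm x, add_comm r]; exact hrt t)
  have e2 := norm_integral_translate_sub_le hh.1 hC' r T
  have e3 := norm_add_le ((∫ t in (0 : ℝ)..T, h (x + t)) - ∫ t in (0 : ℝ)..T, h (r + t))
    ((∫ t in (0 : ℝ)..T, h (r + t)) - ∫ t in (0 : ℝ)..T, h t)
  rw [sub_add_sub_cancel] at e3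
  have : C * |r| ≤ C * (1 + ∑ r ∈ S, |r|) := by gcongr; linarith
  linarith

/-- The integral of `h (x + t)` over `[0, S] × [0, T]` is close both to `S ∫₀ᵀ h` and to `T ∫₀ˢ h`,
according to the order of integration. -/
theorem integral_ratio_close (hh : AlmostPeriodic h) {ε : ℝ} (hε : 0 < ε) :
    ∃ T₀ : ℝ, 0 < T₀ ∧ ∀ T : ℝ, T₀ ≤ T → ∀ S : ℝ, T₀ ≤ S →
      ‖(∫ t in (0 : ℝ)..T, h t) / T - (∫ t in (0 : ℝ)..S, h t) / S‖ ≤ ε := by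
  obtain ⟨T₀, hT₀, H⟩ := hh.integral_translate_close (half_pos hε)
  have key : ∀ T : ℝ, T₀ ≤ T → ∀ S : ℝ, 0 ≤ S →
      ‖(∫ x in (0 : ℝ)..S, ∫ t in (0 : ℝ)..T, h (x + t)) - S * ∫ t in (0 : ℝ)..T, h t‖
        ≤ ε / 2 * T * S := by
    intro T hT S hS
    have hc : Continuous fun x => ∫ t in (0 : ℝ)..T, h (x + t) :=
      intervalIntegral.continuous_parametric_intervalIntegral_of_continuous'
        (f := fun x t => h (x + t)) (hh.1.comp (continuous_fst.add continuous_snd)) _ _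
    have := norm_integral_sub_le_of_norm_sub_le (u := fun x => ∫ t in (0 : ℝ)..T, h (x + t))
      (v := fun _ => ∫ t in (0 : ℝ)..T, h t) hc continuous_const hS (fun x => H T hT x)
    simpa using this
  refine ⟨T₀, hT₀, fun T hT S hS => ?_⟩
  have hT0 := hT₀.trans_le hT
  have hS0 := hT₀.trans_le hS
  have e1 := key T hT S hS0.le
  have e2 := key S hS T hT0.le
  have hsw : (∫ x in (0 : ℝ)..S, ∫ t in (0 : ℝ)..T, h (x + t)) =
      ∫ x in (0 : ℝ)..T, ∫ t in (0 : ℝ)..S, h (x + t) := by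
    rw [intervalIntegral_swap_of_continuous (F := fun x t => h (x + t))
      (hh.1.comp (continuous_fst.add continuous_snd)) hS0.le hT0.le]
    simp only [add_comm]
  rw [hsw] at e1
  have e3 := norm_sub_le ((∫ x in (0 : ℝ)..T, ∫ t in (0 : ℝ)..S, h (x + t)) -
    T * ∫ t in (0 : ℝ)..S, h t) ((∫ x in (0 : ℝ)..T, ∫ t in (0 : ℝ)..S, h (x + t)) -
    S * ∫ t in (0 : ℝ)..T, h t)
  rw [sub_sub_sub_cancel_left] at e3
  have hTc : (T : ℂ) ≠ 0 := by exact_mod_cast hT0.ne'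
  have hSc : (S : ℂ) ≠ 0 := by exact_mod_cast hS0.ne'
  have : (∫ t in (0 : ℝ)..T, h t) / T - (∫ t in (0 : ℝ)..S, h t) / S =
      (S * (∫ t in (0 : ℝ)..T, h t) - T * ∫ t in (0 : ℝ)..S, h t) / (T * S : ℝ) := by
    push_cast
    field_simp
  rw [this, norm_div, Complex.norm_real, Real.norm_of_nonneg (by positivity),
    div_le_iff₀ (by positivity)]
  linarith

theorem exists_mean (hh : AlmostPeriodic h) : ∃ m, HasMean h m := by
  have hcau : CauchySeq fun T : ℝ => (∫ t in (0 : ℝ)..T, h t) / T := by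
    rw [Metric.cauchySeq_iff]
    intro ε hε
    obtain ⟨T₀, -, H⟩ := hh.integral_ratio_close (half_pos hε)
    refine ⟨T₀, fun T hT S hS => ?_⟩
    rw [dist_eq_norm]
    exact (H T hT S hS).trans_lt (half_lt_self hε)
  obtain ⟨m, hm⟩ := cauchySeq_tendsto_of_complete hcau
  refine ⟨m, fun ε hε => ?_⟩
  obtain ⟨T₁, hT₁, H₁⟩ := hh.integral_translate_close (half_pos hε)
  obtain ⟨T₂, H₂⟩ := (Metric.tendsto_atTop.1 hm) (ε / 2) (half_pos hε)
  refine ⟨max T₁ T₂, hT₁.trans_le (le_max_left _ _), fun T hT x => ?_⟩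
  have hT0 : 0 < T := hT₁.trans_le ((le_max_left _ _).trans hT)
  have hTc : (T : ℂ) ≠ 0 := by exact_mod_cast hT0.ne'
  have e1 := H₁ T ((le_max_left _ _).trans hT) x
  have e2 := (H₂ T ((le_max_right _ _).trans hT)).le
  rw [dist_eq_norm] at e2
  have e4 : (∫ t in (0 : ℝ)..T, h t) - T * m = T * ((∫ t in (0 : ℝ)..T, h t) / T - m) := by
    field_simp
  have e5 : ‖(∫ t in (0 : ℝ)..T, h t) - T * m‖ ≤ ε / 2 * T := by
    rw [e4, norm_mul, Complex.norm_real, Real.norm_of_nonneg hT0.le, mul_comm]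
    gcongr
  have e3 := norm_add_le ((∫ t in (0 : ℝ)..T, h (x + t)) - ∫ t in (0 : ℝ)..T, h t)
    ((∫ t in (0 : ℝ)..T, h t) - T * m)
  rw [sub_add_sub_cancel] at e3
  linarith

end AlmostPeriodic

namespace HasMean

variable {h g : ℝ → ℂ} {m n : ℂ}

/-- Stability under simultaneous approximation of the function and of its mean value. -/
theorem of_approx (hc : Continuous h)
    (H : ∀ ε : ℝ, 0 < ε → ∃ (g : ℝ → ℂ) (n : ℂ), Continuous g ∧ HasMean g n ∧
      (∀ t, ‖h t - g t‖ ≤ ε) ∧ ‖m - n‖ ≤ ε) : HasMean h m := by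
  intro ε hε
  obtain ⟨g, n, hgc, hg, hhg, hmn⟩ := H (ε / 3) (by positivity)
  obtain ⟨T₀, hT₀, h1⟩ := hg (ε / 3) (by positivity)
  refine ⟨T₀, hT₀, fun T hT x => ?_⟩
  have hT0 := hT₀.trans_le hT
  have e1 := h1 T hT x
  have e2 := norm_integral_sub_le_of_norm_sub_le (u := fun t => h (x + t))
    (v := fun t => g (x + t)) (hc.comp (continuous_const_add x))
    (hgc.comp (continuous_const_add x)) hT0.le (fun t => hhg _)
  have e3 : ‖(T : ℂ) * (m - n)‖ ≤ ε / 3 * T := by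
    rw [norm_mul, Complex.norm_real, Real.norm_of_nonneg hT0.le, mul_comm]
    gcongr
  have : (∫ t in (0 : ℝ)..T, h (x + t)) - T * m =
      ((∫ t in (0 : ℝ)..T, h (x + t)) - (∫ t in (0 : ℝ)..T, g (x + t))) +
      ((∫ t in (0 : ℝ)..T, g (x + t)) - T * n) - T * (m - n) := by ring
  rw [this]
  calc _ ≤ _ := (norm_sub_le _ _).trans (add_le_add_left (norm_add_le _ _) _)
    _ ≤ ε * T := by linarith

theorem unique (h1 : HasMean h m) (h2 : HasMean h n) : m = n := by
  by_contra hne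
  have hpos : 0 < ‖m - n‖ := norm_pos_iff.2 (sub_ne_zero.2 hne)
  obtain ⟨T₁, hT₁, H₁⟩ := h1 (‖m - n‖ / 3) (by positivity)
  obtain ⟨T₂, hT₂, H₂⟩ := h2 (‖m - n‖ / 3) (by positivity)
  set T := max T₁ T₂
  have hT : 0 < T := hT₁.trans_le (le_max_left _ _)
  have e1 := H₁ T (le_max_left _ _) 0
  have e2 := H₂ T (le_max_right _ _) 0
  have e3 := norm_sub_le ((∫ t in (0 : ℝ)..T, h (0 + t)) - T * n)
    ((∫ t in (0 : ℝ)..T, h (0 + t)) - T * m)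
  rw [sub_sub_sub_cancel_left, ← mul_sub, norm_mul, Complex.norm_real,
    Real.norm_of_nonneg hT.le] at e3
  nlinarith

theorem add (hh : Continuous h) (hg : Continuous g) (h1 : HasMean h m) (h2 : HasMean g n) :
    HasMean (fun t => h t + g t) (m + n) := by
  intro ε hε
  obtain ⟨T₁, hT₁, H₁⟩ := h1 (ε / 2) (by positivity)
  obtain ⟨T₂, hT₂, H₂⟩ := h2 (ε / 2) (by positivity)
  refine ⟨max T₁ T₂, hT₁.trans_le (le_max_left _ _), fun T hT x => ?_⟩
  have e1 := H₁ T ((le_max_left _ _).trans hT) x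
  have e2 := H₂ T ((le_max_right _ _).trans hT) x
  have e3 := intervalIntegral.integral_add (f := fun t => h (x + t)) (g := fun t => g (x + t))
    (μ := MeasureTheory.volume) (a := 0) (b := T)
    ((hh.comp (continuous_const_add x)).intervalIntegrable _ _)
    ((hg.comp (continuous_const_add x)).intervalIntegrable _ _)
  beta_reduce
  rw [e3, mul_add, add_sub_add_comm]
  exact (norm_add_le _ _).trans (by linarith)

theorem const_mul (z : ℂ) (h1 : HasMean h m) : HasMean (fun t => z * h t) (z * m) := by
  intro ε hε
  obtain ⟨T₁, hT₁, H₁⟩ := h1 (ε / (‖z‖ + 1)) (by positivity)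
  refine ⟨T₁, hT₁, fun T hT x => ?_⟩
  have hT0 := hT₁.trans_le hT
  have e1 := H₁ T hT x
  rw [intervalIntegral.integral_const_mul, mul_left_comm, ← mul_sub, norm_mul]
  calc _ ≤ ‖z‖ * (ε / (‖z‖ + 1) * T) := by gcongr
    _ ≤ (‖z‖ + 1) * (ε / (‖z‖ + 1) * T) := by gcongr; linarith
    _ = ε * T := by field_simp

theorem zero : HasMean (fun _ => 0) 0 := fun ε hε =>
  ⟨1, one_pos, fun T hT x => by
    have : 0 < T := one_pos.trans_le hT
    simpa using by positivity⟩

theorem sum {ι : Type*} (s : Finset ι) {h : ι → ℝ → ℂ} {m : ι → ℂ}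
    (hc : ∀ i ∈ s, Continuous (h i)) (hm : ∀ i ∈ s, HasMean (h i) (m i)) :
    HasMean (fun t => ∑ i ∈ s, h i t) (∑ i ∈ s, m i) := by
  classical
  induction s using Finset.induction_on with
  | empty => simpa using zero
  | insert a s ha ih =>
    simp only [Finset.sum_insert ha]
    refine add (hc a (Finset.mem_insert_self _ _)) ?_ (hm a (Finset.mem_insert_self _ _)) ?_
    · exact continuous_finsetSum _ fun i hi => hc i (Finset.mem_insert_of_mem hi)
    · exact ih (fun i hi => hc i (Finset.mem_insert_of_mem hi))
        (fun i hi => hm i (Finset.mem_insert_of_mem hi))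

/-- Comparison with a nonnegative majorant. -/
theorem norm_le {k : ℝ → ℝ} {K : ℝ} (hk : Continuous k) (h1 : HasMean h m)
    (h2 : HasMean (fun t => (k t : ℂ)) K) (hle : ∀ t, ‖h t‖ ≤ k t) : ‖m‖ ≤ K := by
  refine le_of_forall_pos_le_add fun ε hε => ?_
  obtain ⟨T₁, hT₁, H₁⟩ := h1 (ε / 2) (by positivity)
  obtain ⟨T₂, hT₂, H₂⟩ := h2 (ε / 2) (by positivity)
  set T := max T₁ T₂
  have hT : 0 < T := hT₁.trans_le (le_max_left _ _)
  have e1 := H₁ T (le_max_left _ _) 0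
  have e2 := H₂ T (le_max_right _ _) 0
  simp only [zero_add] at e1 e2
  rw [intervalIntegral.integral_ofReal, ← Complex.ofReal_mul, ← Complex.ofReal_sub,
    Complex.norm_real, Real.norm_eq_abs] at e2
  have e3 : ‖∫ t in (0 : ℝ)..T, h t‖ ≤ ∫ t in (0 : ℝ)..T, k t :=
    intervalIntegral.norm_integral_le_of_norm_le hT.le
      (Eventually.of_forall fun t _ => hle t) (hk.intervalIntegrable _ _)
  have e4 := norm_sub_norm_le ((T : ℂ) * m) (∫ t in (0 : ℝ)..T, h t)
  rw [norm_sub_rev, norm_mul, Complex.norm_real, Real.norm_of_nonneg hT.le] at e4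
  have e5 := (abs_le.1 e2).2
  have : T * ‖m‖ ≤ T * (K + ε) := by nlinarith
  exact le_of_mul_le_mul_left this hT

theorem const (z : ℂ) : HasMean (fun _ => z) z := fun ε hε =>
  ⟨1, one_pos, fun T hT x => by
    have : 0 < T := one_pos.trans_le hT
    simpa using by positivity⟩

theorem char_of_ne_zero {lam : ℝ} (hl : lam ≠ 0) : HasMean (realChar lam) 0 := by
  intro ε hε
  refine ⟨2 / (|lam| * ε), by positivity, fun T hT x => ?_⟩
  rw [div_le_iff₀ (by positivity)] at hT
  have hI : (Complex.I * (lam : ℂ)) ≠ 0 := by simp [hl]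
  have : ∫ t in (0 : ℝ)..T, realChar lam (x + t) =
      realChar lam x * ((realChar lam T - realChar lam 0) / (Complex.I * lam)) := by
    simp only [realChar_add_right]
    rw [intervalIntegral.integral_const_mul]
    congr 1
    have := integral_exp_mul_complex (a := 0) (b := T) hI
    simp only [realChar]
    push_cast
    simp only [← mul_assoc]
    rw [this]
    push_cast
    rfl
  rw [this, mul_zero, sub_zero, norm_mul, norm_realChar, one_mul, norm_div, norm_mul,
    Complex.norm_I, one_mul, Complex.norm_real, Real.norm_eq_abs, div_le_iff₀ (by positivity)]
  have := norm_sub_le (realChar lam T) (realChar lam 0)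
  rw [norm_realChar, norm_realChar] at this
  linarith

theorem char (lam : ℝ) : HasMean (realChar lam) (if lam = 0 then 1 else 0) := by
  split_ifs with hl
  · subst hl
    simpa [funext realChar_zero_left] using const 1
  · exact char_of_ne_zero hl

theorem translate (h1 : HasMean h m) (y : ℝ) : HasMean (fun t => h (t + y)) m := by
  intro ε hε
  obtain ⟨T₀, hT₀, H⟩ := h1 ε hε
  refine ⟨T₀, hT₀, fun T hT x => ?_⟩
  have := H T hT (x + y)
  simpa only [add_right_comm] using this

/-- Uniformity over translates lets the interval start at `-T`; this is the link with the symmetric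
means in `IsDirichletCoeff`. -/
theorem tendsto_symmetric (h1 : HasMean h m) :
    Tendsto (fun T : ℝ => ((2 * T : ℝ) : ℂ)⁻¹ * ∫ t in (-T)..T, h t) atTop (𝓝 m) := by
  rw [Metric.tendsto_atTop]
  intro ε hε
  obtain ⟨T₁, hT₁, H₁⟩ := h1 (ε / 2) (by positivity)
  refine ⟨T₁, fun T hT => ?_⟩
  have hT0 := hT₁.trans_le hT
  have e1 := H₁ (2 * T) (by linarith) (-T)
  rw [intervalIntegral.integral_comp_add_left (fun t => h t), show -T + 2 * T = T by ring,
    add_zero] at e1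
  have hc : ((2 * T : ℝ) : ℂ) ≠ 0 := by exact_mod_cast (by positivity : (2 * T) ≠ 0)
  rw [dist_eq_norm, show ((2 * T : ℝ) : ℂ)⁻¹ * (∫ t in (-T)..T, h t) - m =
    ((2 * T : ℝ) : ℂ)⁻¹ * ((∫ t in (-T)..T, h t) - ((2 * T : ℝ) : ℂ) * m) by field_simp,
    norm_mul, norm_inv, Complex.norm_real, Real.norm_of_nonneg (by positivity),
    inv_mul_lt_iff₀ (by positivity)]
  nlinarith

end HasMean

/-! ### Riesz products: Bohr's inequality and Kronecker's theorem -/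

theorem realChar_sum {ι : Type*} (s : Finset ι) (lam : ι → ℝ) (t : ℝ) :
    realChar (∑ i ∈ s, lam i) t = ∏ i ∈ s, realChar (lam i) t := by
  classical
  induction s using Finset.induction_on with
  | empty => simp
  | insert a s ha ih => rw [Finset.sum_insert ha, Finset.prod_insert ha, realChar_add_left, ih]

theorem realChar_nat_mul (n : ℕ) (lam t : ℝ) : realChar (n * lam) t = realChar lam t ^ n := by
  induction n with
  | zero => simp
  | succ n ih => rw [pow_succ, ← ih, ← realChar_add_left]; congr 1; push_cast; ring

theorem realChar_neg (lam t : ℝ) : realChar (-lam) t = (starRingEnd ℂ) (realChar lam t) := by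
  unfold realChar
  rw [← Complex.exp_conj]
  congr 1
  simp

theorem mul_conj_eq_one_of_norm {z : ℂ} (hz : ‖z‖ = 1) : z * (starRingEnd ℂ) z = 1 := by
  rw [Complex.mul_conj, Complex.normSq_eq_norm_sq, hz]
  simp

/-- The nonnegative trigonometric polynomial `|1 + c e^{iλt}|^{2N} / 4^N`. -/
noncomputable def peakFactor (N : ℕ) (c : ℂ) (lam t : ℝ) : ℝ :=
  (‖1 + c * realChar lam t‖ ^ 2 / 4) ^ N

/-- The coefficient of `e^{i(m-N)λt}` in `peakFactor N c λ t`. -/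
noncomputable def peakCoeff (N : ℕ) (c : ℂ) (m : ℕ) : ℂ :=
  ((2 * N).choose m : ℂ) / 4 ^ N * (c ^ m * (starRingEnd ℂ) c ^ N)

theorem continuous_peakFactor (N : ℕ) (c : ℂ) (lam : ℝ) : Continuous (peakFactor N c lam) := by
  have := continuous_realChar lam
  unfold peakFactor
  fun_prop

theorem peakFactor_nonneg (N : ℕ) (c : ℂ) (lam t : ℝ) : 0 ≤ peakFactor N c lam t := by
  unfold peakFactor
  positivity

/-- For `|z| = 1` one has `|1 + z|² = (1 + z)² z̄`, so the power is a binomial expansion of `(1 +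
z)^{2N}` recentred by `z̄^N`. -/
theorem peakFactor_eq_sum (N : ℕ) {c : ℂ} (hc : ‖c‖ = 1) (lam t : ℝ) :
    (peakFactor N c lam t : ℂ) =
      ∑ m ∈ Finset.range (2 * N + 1), peakCoeff N c m * realChar (((m : ℝ) - N) * lam) t := by
  set z := c * realChar lam t with hz
  have hz1 : ‖z‖ = 1 := by rw [hz, norm_mul, hc, norm_realChar, one_mul]
  have hzz := mul_conj_eq_one_of_norm hz1
  have h1 : ((‖1 + z‖ ^ 2 : ℝ) : ℂ) = (1 + z) ^ 2 * (starRingEnd ℂ) z := by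
    rw [← Complex.normSq_eq_norm_sq, ← Complex.mul_conj, map_add, map_one]
    linear_combination (-1 - z) * hzz
  have h2 : (peakFactor N c lam t : ℂ) = (z + 1) ^ (2 * N) * (starRingEnd ℂ) z ^ N / 4 ^ N := by
    unfold peakFactor
    rw [← hz, Complex.ofReal_pow, Complex.ofReal_div, h1, div_pow, mul_pow, ← pow_mul, add_comm 1 z]
    norm_num
  rw [h2, add_pow, Finset.sum_mul, Finset.sum_div]
  refine Finset.sum_congr rfl fun m _ => ?_
  rw [sub_mul, sub_eq_add_neg, realChar_add_left, realChar_neg, realChar_nat_mul,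
    realChar_nat_mul, hz, peakCoeff]
  simp only [map_mul, map_pow, mul_pow, one_pow]
  ring

section Product

variable {ι : Type*} [Fintype ι] [DecidableEq ι]

theorem prod_peakFactor_eq_sum (N : ι → ℕ) {c : ι → ℂ} (hc : ∀ i, ‖c i‖ = 1) (lam : ι → ℝ)
    (t : ℝ) :
    ((∏ i, peakFactor (N i) (c i) (lam i) t : ℝ) : ℂ) =
      ∑ p ∈ Fintype.piFinset fun i => Finset.range (2 * N i + 1),
        (∏ i, peakCoeff (N i) (c i) (p i)) *
          realChar (∑ i, (((p i : ℤ) - N i : ℤ) : ℝ) * lam i) t := by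
  rw [Complex.ofReal_prod]
  simp only [peakFactor_eq_sum _ (hc _)]
  rw [Finset.prod_univ_sum]
  refine Finset.sum_congr rfl fun p _ => ?_
  rw [Finset.prod_mul_distrib, realChar_sum]
  simp

theorem hasMean_mul_prod_peakFactor (N : ι → ℕ) {c : ι → ℂ} (hc : ∀ i, ‖c i‖ = 1) (lam : ι → ℝ)
    {h : ℝ → ℂ} (hh : Continuous h) {A : ℝ → ℂ}
    (hA : ∀ ν, HasMean (fun t => h t * realChar ν t) (A ν)) :
    HasMean (fun t => h t * ((∏ i, peakFactor (N i) (c i) (lam i) t : ℝ) : ℂ))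
      (∑ p ∈ Fintype.piFinset fun i => Finset.range (2 * N i + 1),
        (∏ i, peakCoeff (N i) (c i) (p i)) *
          A (∑ i, (((p i : ℤ) - N i : ℤ) : ℝ) * lam i)) := by
  have := HasMean.sum (Fintype.piFinset fun i => Finset.range (2 * N i + 1))
    (h := fun p t => (∏ i, peakCoeff (N i) (c i) (p i)) *
      (h t * realChar (∑ i, (((p i : ℤ) - N i : ℤ) : ℝ) * lam i) t))
    (fun p _ => continuous_const.mul (hh.mul (continuous_realChar _)))
    (fun p _ => (hA _).const_mul _)
  convert this using 2 with t
  rw [prod_peakFactor_eq_sum N hc lam t, Finset.mul_sum]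
  exact Finset.sum_congr rfl fun p _ => by ring

theorem peakCoeff_self (N : ℕ) {c : ℂ} (hc : ‖c‖ = 1) :
    peakCoeff N c N = (N.centralBinom : ℂ) / 4 ^ N := by
  rw [peakCoeff, ← mul_pow, mul_conj_eq_one_of_norm hc, one_pow, mul_one, Nat.centralBinom]

/-- By independence the frequency of a term vanishes only for `p = N`, so the mean of the product is
the product of the central coefficients. -/
theorem hasMean_prod_peakFactor (N : ι → ℕ) {c : ι → ℂ} (hc : ∀ i, ‖c i‖ = 1) {lam : ι → ℝ}
    (hind : ∀ q : ι → ℤ, ∑ i, (q i : ℝ) * lam i = 0 → q = 0) :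
    HasMean (fun t => ((∏ i, peakFactor (N i) (c i) (lam i) t : ℝ) : ℂ))
      ((∏ i, ((N i).centralBinom : ℝ) / 4 ^ N i : ℝ) : ℂ) := by
  have := hasMean_mul_prod_peakFactor N hc lam (h := fun _ => 1) continuous_const
    (A := fun ν => if ν = 0 then 1 else 0) (fun ν => by simpa using HasMean.char ν)
  simp only [one_mul] at this
  convert this using 1
  rw [Finset.sum_eq_single N]
  · simp only [sub_self, Int.cast_zero, zero_mul, Finset.sum_const_zero, if_true, mul_one,
      peakCoeff_self _ (hc _)]
    push_cast
    rfl
  · intro p _ hp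
    rw [if_neg, mul_zero]
    intro h0
    apply hp
    have := hind _ h0
    funext i
    have hi := congrFun this i
    simp only [Pi.zero_apply, sub_eq_zero] at hi
    exact_mod_cast hi
  · intro hN
    exact absurd (Fintype.mem_piFinset.2 fun i => Finset.mem_range.2 (by omega)) hN

/-- **Bohr's inequality** for almost periodic functions with independent exponents. -/
theorem sum_norm_coeff_le {lam : ι → ℝ}
    {h : ℝ → ℂ} (hh : Continuous h) {C : ℝ} (hC : ∀ t, ‖h t‖ ≤ C) {a : ℝ → ℂ}
    (ha : ∀ ν, HasMean (fun t => h t * realChar (-ν) t) (a ν))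
    (hind : ∀ q : ι → ℤ, ∑ i, (q i : ℝ) * lam i = 0 → q = 0)
    (hsupp : ∀ q : ι → ℤ, a (∑ i, (q i : ℝ) * lam i) ≠ 0 → ∃ i, q = Pi.single i 1) :
    ∑ i, ‖a (lam i)‖ ≤ 2 * C := by
  have hc : ∀ i, ∃ c : ℂ, ‖c‖ = 1 ∧ (starRingEnd ℂ) c * a (lam i) = ‖a (lam i)‖ := by
    intro i
    by_cases h0 : a (lam i) = 0
    · exact ⟨1, by simp, by simp [h0]⟩
    · have h0' : (‖a (lam i)‖ : ℂ) ≠ 0 := by simpa using h0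
      refine ⟨a (lam i) / ‖a (lam i)‖, by simp [h0], ?_⟩
      rw [map_div₀, Complex.conj_ofReal, div_mul_eq_mul_div, mul_comm, Complex.mul_conj,
        Complex.normSq_eq_norm_sq]
      field_simp
      push_cast
      ring
  choose c hc1 hc2 using hc
  -- The Riesz product is nonnegative with mean `2^{-n}`, where `n` is the number of indices, so the
  -- mean of `h` times it is at most `C 2^{-n}` in modulus.
  have hA := hasMean_mul_prod_peakFactor (fun _ => 1) hc1 lam hh (A := fun ν => a (-ν))
    (fun ν => by simpa using ha (-ν))
  have hK := hasMean_prod_peakFactor (fun _ => 1) hc1 hind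
  have hK' := hK.const_mul (C : ℂ)
  have hcont : Continuous fun t => C * ∏ i, peakFactor 1 (c i) (lam i) t :=
    continuous_const.mul (continuous_finsetProd _ fun i _ => continuous_peakFactor _ _ _)
  rw [← Complex.ofReal_mul] at hK'
  have hle := hA.norm_le (k := fun t => C * ∏ i, peakFactor 1 (c i) (lam i) t)
    (K := C * ∏ _i : ι, ((Nat.centralBinom 1 : ℕ) : ℝ) / 4 ^ 1) hcont (by
      convert hK' using 2 with t
      push_cast
      rfl) (fun t => by
      have h0 : 0 ≤ ∏ i, peakFactor 1 (c i) (lam i) t :=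
        Finset.prod_nonneg fun i _ => peakFactor_nonneg _ _ _ _
      rw [norm_mul, Complex.norm_real, Real.norm_of_nonneg h0]
      exact mul_le_mul_of_nonneg_right (hC t) h0)
  -- By `hsupp` only the `p` equal to `1` except for a single `0` contribute. Such a factor has
  -- coefficient `c̄ᵢ / 4` instead of the central `1 / 2`; this ratio is the origin of the constant
  -- `2` in the bound.
  have hsum : (∑ p ∈ Fintype.piFinset fun _ : ι => Finset.range (2 * 1 + 1),
        (∏ i, peakCoeff 1 (c i) (p i)) *
          a (-∑ i, (((p i : ℤ) - (1 : ℕ) : ℤ) : ℝ) * lam i)) =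
      ∑ i, (((1 / 2) ^ Fintype.card ι / 2 * ‖a (lam i)‖ : ℝ) : ℂ) := by
    symm
    refine Finset.sum_of_injOn (fun i => Function.update (fun _ => 1) i 0) ?_ ?_ ?_ ?_
    · intro i _ j _ hij
      by_contra hne
      have := congrFun hij i
      simp [Function.update_of_ne hne] at this
    · intro i _
      simp only [Finset.mem_coe, Fintype.mem_piFinset, Finset.mem_range]
      intro j
      rcases eq_or_ne j i with rfl | hji
      · simp
      · simp [Function.update_of_ne hji]
    · intro p _ hp
      suffices a (-∑ i, (((p i : ℤ) - (1 : ℕ) : ℤ) : ℝ) * lam i) = 0 by rw [this, mul_zero]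
      by_contra hne
      apply hp
      have h1 : -∑ i, (((p i : ℤ) - (1 : ℕ) : ℤ) : ℝ) * lam i =
          ∑ i, ((1 - (p i : ℤ) : ℤ) : ℝ) * lam i := by
        rw [← Finset.sum_neg_distrib]
        refine Finset.sum_congr rfl fun i _ => ?_
        push_cast
        ring
      rw [h1] at hne
      obtain ⟨i, hi⟩ := hsupp _ hne
      refine ⟨i, by simp, funext fun j => ?_⟩
      have hj := congrFun hi j
      rcases eq_or_ne j i with rfl | hji
      · simp only [Pi.single_eq_same] at hj
        simp only [Function.update_self]
        omega
      · simp only [Pi.single_eq_of_ne hji] at hj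
        simp only [Function.update_of_ne hji]
        omega
    · intro i _
      have h1 : -∑ j, (((Function.update (fun _ => 1) i 0 j : ℕ) : ℤ) - (1 : ℕ) : ℤ) * lam j =
          lam i := by
        rw [Finset.sum_eq_single i]
        · simp
        · intro j _ hji
          simp [Function.update_of_ne hji]
        · simp
      have h2 : ∏ j, peakCoeff 1 (c j) (Function.update (fun _ => 1) i 0 j) =
          (1 / 2) ^ Fintype.card ι / 2 * (starRingEnd ℂ) (c i) := by
        rw [← Finset.mul_prod_erase Finset.univ _ (Finset.mem_univ i)]
        have h3 : ∀ j ∈ Finset.univ.erase i,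
            peakCoeff 1 (c j) (Function.update (fun _ => 1) i 0 j) = (1 / 2 : ℂ) := by
          intro j hj
          rw [Function.update_of_ne (Finset.ne_of_mem_erase hj), peakCoeff_self 1 (hc1 j)]
          norm_num [Nat.centralBinom]
        rw [Finset.prod_congr rfl h3, Finset.prod_const,
          Finset.card_erase_of_mem (Finset.mem_univ i), Finset.card_univ]
        have h4 : Fintype.card ι = (Fintype.card ι - 1) + 1 :=
          (Nat.sub_add_cancel (Fintype.card_pos_iff.2 ⟨i⟩)).symm
        conv_rhs => rw [h4, pow_succ]
        simp [peakCoeff]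
        ring
      rw [h1, h2, mul_assoc, hc2]
      push_cast
      rfl
  rw [hsum, ← Complex.ofReal_sum, Complex.norm_real, ← Finset.mul_sum, Real.norm_of_nonneg
    (by positivity), Finset.prod_const, Finset.card_univ] at hle
  have h5 : ((Nat.centralBinom 1 : ℕ) : ℝ) / 4 ^ 1 = 1 / 2 := by norm_num [Nat.centralBinom]
  rw [h5] at hle
  have h6 : (0 : ℝ) < (1 / 2) ^ Fintype.card ι := by positivity
  have : ((1 : ℝ) / 2) ^ Fintype.card ι * (∑ i, ‖a (lam i)‖) ≤
      (1 / 2) ^ Fintype.card ι * (2 * C) := by linarith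
  exact le_of_mul_le_mul_left this h6

/-- **Kronecker's theorem** on simultaneous approximation, continuous version. -/
theorem exists_realChar_near {lam : ι → ℝ}
    (hind : ∀ q : ι → ℤ, ∑ i, (q i : ℝ) * lam i = 0 → q = 0) {c : ι → ℂ} (hc : ∀ i, ‖c i‖ = 1)
    {ε : ℝ} (hε : 0 < ε) : ∃ t : ℝ, ∀ i, ‖realChar (lam i) t - c i‖ ≤ ε := by
  by_contra! hcon
  set d : ι → ℂ := fun i => (starRingEnd ℂ) (c i) with hd
  have hd1 : ∀ i, ‖d i‖ = 1 := fun i => by rw [hd, RCLike.norm_conj, hc]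
  -- By the parallelogram law `|1 + z|² / 4 = 1 - |1 - z|² / 4` on the unit circle, so a factor
  -- whose character is `ε`-far from its target is at most `ρ` before taking powers.
  set ρ : ℝ := 1 - ε ^ 2 / 4
  have hfar : ∀ t i, ε < ‖realChar (lam i) t - c i‖ →
      ‖1 + d i * realChar (lam i) t‖ ^ 2 / 4 ≤ ρ := by
    intro t i hi
    set z := d i * realChar (lam i) t with hz
    have hz1 : ‖z‖ = 1 := by rw [hz, norm_mul, hd1, norm_realChar, one_mul]
    have hzz : ‖1 - z‖ = ‖realChar (lam i) t - c i‖ := by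
      have : 1 - z = -(d i * (realChar (lam i) t - c i)) := by
        have := mul_conj_eq_one_of_norm (hc i)
        simp only [hz, hd]
        linear_combination -this
      rw [this, norm_neg, norm_mul, hd1, one_mul]
    have hpl := parallelogram_law_with_norm ℝ (1 : ℂ) z
    rw [hz1, norm_one, hzz] at hpl
    have : ε ^ 2 ≤ ‖realChar (lam i) t - c i‖ ^ 2 := by gcongr
    simp only [ρ]
    nlinarith
  have hρ0 : 0 ≤ ρ := by
    obtain ⟨i, hi⟩ := hcon 0
    exact le_trans (by positivity) (hfar 0 i hi)
  have hρ1 : ρ < 1 := by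
    have : 0 < ε ^ 2 / 4 := by positivity
    simp only [ρ]
    linarith
  set n := Fintype.card ι
  -- If at every `t` some factor is at most `ρ ^ N`, the product is dominated by the sum over `i` of
  -- `ρ ^ N` times the product without the factor `i`. Taking means gives `w ^ n ≤ n ρ ^ N w ^ (n -
  -- 1)`. Since the central coefficient `w` is at least `1 / N`, this is absurd for large `N`.
  have key : ∀ N : ℕ, 4 ≤ N → 1 ≤ (n : ℝ) * (N * ρ ^ N) := by
    intro N hN
    set w : ℝ := (N.centralBinom : ℝ) / 4 ^ N with hw
    have hw0 : 0 < w := by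
      have := N.centralBinom_pos
      positivity
    have hw1 : 1 ≤ N * w := by
      have := Nat.four_pow_lt_mul_centralBinom N hN
      have h4 : (4 : ℝ) ^ N ≤ N * N.centralBinom := by exact_mod_cast this.le
      rw [hw, mul_div_assoc', le_div_iff₀ (by positivity)]
      linarith
    have hm1 := hasMean_prod_peakFactor (fun _ => N) hd1 hind
    -- Exponent `0` makes the factor `i` equal to `1`, which removes it without changing the index
    -- type.
    have hm2 := fun i => hasMean_prod_peakFactor (fun j => if j = i then 0 else N) hd1 hind
    have hm3 := HasMean.sum (Finset.univ : Finset ι)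
      (h := fun i t => ((ρ ^ N : ℝ) : ℂ) *
        ((∏ j, peakFactor (if j = i then 0 else N) (d j) (lam j) t : ℝ) : ℂ))
      (fun i _ => continuous_const.mul (Complex.continuous_ofReal.comp
        (continuous_finsetProd _ fun j _ => continuous_peakFactor _ _ _)))
      (fun i _ => (hm2 i).const_mul ((ρ ^ N : ℝ) : ℂ))
    have hw2 : ∀ i : ι, ∏ j : ι, (((if j = i then 0 else N).centralBinom : ℕ) : ℝ) /
        4 ^ (if j = i then 0 else N) = w ^ (n - 1) := by
      intro i
      rw [← Finset.mul_prod_erase Finset.univ _ (Finset.mem_univ i)]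
      have h3 : ∀ j ∈ Finset.univ.erase i, (((if j = i then 0 else N).centralBinom : ℕ) : ℝ) /
          4 ^ (if j = i then 0 else N) = w := by
        intro j hj
        rw [if_neg (Finset.ne_of_mem_erase hj)]
      rw [Finset.prod_congr rfl h3, Finset.prod_const,
          Finset.card_erase_of_mem (Finset.mem_univ i), Finset.card_univ]
      simp [n]
    have hle := hm1.norm_le
      (k := fun t => ∑ i, ρ ^ N * ∏ j, peakFactor (if j = i then 0 else N) (d j) (lam j) t)
      (K := ∑ _i : ι, ρ ^ N * w ^ (n - 1))
      (continuous_finsetSum _ fun i _ => continuous_const.mul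
        (continuous_finsetProd _ fun j _ => continuous_peakFactor _ _ _))
      (by
        convert hm3 using 2 with t
        · push_cast
          rfl
        · rw [Complex.ofReal_sum]
          refine Finset.sum_congr rfl fun i _ => ?_
          rw [hw2, Complex.ofReal_mul])
      (fun t => by
        rw [Complex.norm_real, Real.norm_of_nonneg
          (Finset.prod_nonneg fun i _ => peakFactor_nonneg _ _ _ _)]
        obtain ⟨i, hi⟩ := hcon t
        refine le_trans ?_ (Finset.single_le_sum (f := fun i => ρ ^ N *
          ∏ j, peakFactor (if j = i then 0 else N) (d j) (lam j) t)
          (fun i _ => mul_nonneg (by positivity)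
            (Finset.prod_nonneg fun i _ => peakFactor_nonneg _ _ _ _)) (Finset.mem_univ i))
        rw [← Finset.mul_prod_erase Finset.univ _ (Finset.mem_univ i),
          ← Finset.mul_prod_erase Finset.univ (fun j => peakFactor (if j = i then 0 else N) _ _ _)
            (Finset.mem_univ i)]
        have h3 : ∀ j ∈ Finset.univ.erase i, peakFactor (if j = i then 0 else N) (d j) (lam j) t
            = peakFactor N (d j) (lam j) t := by
          intro j hj
          rw [if_neg (Finset.ne_of_mem_erase hj)]
        rw [Finset.prod_congr rfl h3, if_pos rfl]
        have h4 : peakFactor 0 (d i) (lam i) t = 1 := by simp [peakFactor]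
        rw [h4, one_mul]
        have h5 : peakFactor N (d i) (lam i) t ≤ ρ ^ N := by
          unfold peakFactor
          exact pow_le_pow_left₀ (by positivity) (hfar t i hi) N
        exact mul_le_mul_of_nonneg_right h5
          (Finset.prod_nonneg fun i _ => peakFactor_nonneg _ _ _ _))
    rw [Complex.norm_real, Finset.prod_const, Finset.card_univ, Finset.sum_const,
      Finset.card_univ, nsmul_eq_mul, Real.norm_of_nonneg (by positivity)] at hle
    change w ^ n ≤ n * (ρ ^ N * w ^ (n - 1)) at hle
    obtain ⟨i, _⟩ := hcon 0
    have hn0 : 0 < n := (Fintype.card_pos_iff (α := ι)).2 ⟨i⟩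
    have hn : n = (n - 1) + 1 := (Nat.sub_add_cancel hn0).symm
    have h7 : w ^ n = w ^ (n - 1) * w := by
      conv_lhs => rw [hn, pow_succ]
    rw [h7] at hle
    have h8 : w ≤ n * ρ ^ N := by
      have : w ^ (n - 1) * w ≤ w ^ (n - 1) * (n * ρ ^ N) := by linarith
      exact le_of_mul_le_mul_left this (by positivity)
    calc 1 ≤ N * w := hw1
      _ ≤ N * (n * ρ ^ N) := by gcongr
      _ = n * (N * ρ ^ N) := by ring
  have hlim := (tendsto_self_mul_const_pow_of_lt_one hρ0 hρ1).const_mul (n : ℝ)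
  rw [mul_zero] at hlim
  have := ge_of_tendsto hlim (eventually_atTop.2 ⟨4, key⟩)
  linarith

end Product

/-! ### Parseval's identity and autocorrelation on a circle -/

section Circle

open MeasureTheory AddCircle

variable {L : ℝ} [hL : Fact (0 < L)]

theorem hasSum_sq_fourierCoeff_of_memLp {v : AddCircle L → ℂ}
    (hv : MemLp v 2 (haarAddCircle (T := L))) :
    HasSum (fun n => ‖fourierCoeff v n‖ ^ 2) (∫ t, ‖v t‖ ^ 2 ∂(haarAddCircle (T := L))) := by
  convert hasSum_sq_fourierCoeff hv.toLp using 1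
  · simp [fourierCoeff_congr_ae hv.coeFn_toLp]
  · apply integral_congr_ae
    filter_upwards [hv.coeFn_toLp] with x hx
    simp [hx]

/-- Fubini and the substitution `t ↦ t - s`, under which the character splits into a factor in `t`
and a factor in `s`. -/
theorem fourierCoeff_autocorrelation {u : AddCircle L → ℂ} (hu : Measurable u) {C : ℝ}
    (hC : ∀ x, ‖u x‖ ≤ C) (n : ℤ) :
    fourierCoeff (fun t => ∫ s, u (s + t) * (starRingEnd ℂ) (u s) ∂(haarAddCircle (T := L))) n =
      fourierCoeff u n * (starRingEnd ℂ) (fourierCoeff u n) := by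
  have hC0 : 0 ≤ C := (norm_nonneg _).trans (hC 0)
  unfold fourierCoeff
  simp only [smul_eq_mul, ← integral_const_mul]
  rw [integral_integral_swap]
  · have h1 : ∀ s, ∫ t, fourier (-n) t * (u (s + t) * (starRingEnd ℂ) (u s))
        ∂(haarAddCircle (T := L)) =
        (∫ t, fourier (-n) t * u t ∂(haarAddCircle (T := L))) *
          (starRingEnd ℂ) (fourier (-n) s * u s) := by
      intro s
      have h2 := integral_add_left_eq_self (μ := haarAddCircle (T := L))
        (fun t => fourier (-n) (t - s) * (u t * (starRingEnd ℂ) (u s))) s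
      simp only [add_sub_cancel_left] at h2
      rw [h2, ← integral_mul_const]
      congr 1
      funext t
      have h3 : (fourier (-n) (t - s) : ℂ) =
          fourier (-n) t * (starRingEnd ℂ) (fourier (-n) s : ℂ) := by
        rw [← fourier_neg, sub_eq_add_neg]
        simp only [fourier_apply, smul_add, smul_neg, neg_smul, AddCircle.toCircle_add,
          Circle.coe_mul]
      rw [h3, map_mul]
      ring
    simp only [h1]
    rw [integral_const_mul, integral_conj]
  · have hm : Measurable (Function.uncurry fun (t s : AddCircle L) =>
        fourier (-n) t * (u (s + t) * (starRingEnd ℂ) (u s))) := by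
      refine Measurable.mul ?_ (Measurable.mul ?_ ?_)
      · exact (fourier (-n)).continuous.measurable.comp measurable_fst
      · exact hu.comp (measurable_snd.add measurable_fst)
      · exact Complex.continuous_conj.measurable.comp (hu.comp measurable_snd)
    refine Integrable.of_bound hm.aestronglyMeasurable (1 * (C * C)) (Eventually.of_forall ?_)
    rintro ⟨t, s⟩
    simp only [Function.uncurry]
    rw [norm_mul, norm_mul, RCLike.norm_conj]
    have h4 : ‖(fourier (-n) t : ℂ)‖ ≤ 1 := by
      rw [fourier_apply]; exact (Circle.norm_coe _).le
    gcongr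
    · exact hC _
    · exact hC _

/-- The coefficients of the autocorrelation are `|û(n)|²`, so by Parseval its squared norm is `∑
|û(n)|⁴ ≤ η² ∑ |û(n)|² ≤ η² C²`. -/
theorem integral_norm_autocorrelation_le {u : AddCircle L → ℂ} (hu : Measurable u) {C η : ℝ}
    (hCpos : 0 < C) (hη : 0 < η) (hC : ∀ x, ‖u x‖ ≤ C) (hcoeff : ∀ n, ‖fourierCoeff u n‖ ≤ η) :
    ∫ t, ‖∫ s, u (s + t) * (starRingEnd ℂ) (u s) ∂(haarAddCircle (T := L))‖
      ∂(haarAddCircle (T := L)) ≤ η * C := by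
  set G : AddCircle L → ℂ := fun t => ∫ s, u (s + t) * (starRingEnd ℂ) (u s)
    ∂(haarAddCircle (T := L)) with hG
  have hGm : StronglyMeasurable G := by
    have hm : Measurable (Function.uncurry fun (t s : AddCircle L) =>
        u (s + t) * (starRingEnd ℂ) (u s)) := by
      refine Measurable.mul ?_ ?_
      · exact hu.comp (measurable_snd.add measurable_fst)
      · exact Complex.continuous_conj.measurable.comp (hu.comp measurable_snd)
    exact hm.stronglyMeasurable.integral_prod_right
  have hGb : ∀ t, ‖G t‖ ≤ C * C := by
    intro t
    have := norm_integral_le_of_norm_le_const (μ := haarAddCircle (T := L))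
      (f := fun s => u (s + t) * (starRingEnd ℂ) (u s)) (C := C * C)
      (Eventually.of_forall fun s => by
        rw [norm_mul, RCLike.norm_conj]
        gcongr
        · exact hC _
        · exact hC _)
    simpa using this
  have hsumG := hasSum_sq_fourierCoeff_of_memLp
    (MemLp.of_bound (p := 2) hGm.aestronglyMeasurable (C * C) (Eventually.of_forall hGb))
  have hsumu := hasSum_sq_fourierCoeff_of_memLp
    (MemLp.of_bound (p := 2) hu.aestronglyMeasurable C (Eventually.of_forall hC))
  have hint2 : Integrable (fun t => ‖G t‖ ^ 2) (haarAddCircle (T := L)) :=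
    Integrable.of_bound (hGm.norm.pow 2).aestronglyMeasurable ((C * C) ^ 2)
      (Eventually.of_forall fun t => by
        rw [norm_pow, norm_norm]
        have := hGb t
        gcongr)
  have hint1 : Integrable (fun t => ‖G t‖) (haarAddCircle (T := L)) :=
    Integrable.of_bound hGm.norm.aestronglyMeasurable (C * C)
      (Eventually.of_forall fun t => by rw [norm_norm]; exact hGb t)
  have hu2 : ∫ t, ‖u t‖ ^ 2 ∂(haarAddCircle (T := L)) ≤ C ^ 2 := by
    have := norm_integral_le_of_norm_le_const (μ := haarAddCircle (T := L))
      (f := fun s => ‖u s‖ ^ 2) (C := C ^ 2)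
      (Eventually.of_forall fun s => by
        rw [norm_pow, norm_norm]
        have := hC s
        gcongr)
    simp only [Measure.real, measure_univ, ENNReal.toReal_one, mul_one] at this
    exact (le_abs_self _).trans this
  have hG2 : ∫ t, ‖G t‖ ^ 2 ∂(haarAddCircle (T := L)) ≤ η ^ 2 * C ^ 2 := by
    refine le_trans (hasSum_le (fun n => ?_) hsumG (hsumu.mul_left (η ^ 2)))
      (by gcongr)
    rw [hG, fourierCoeff_autocorrelation hu hC, norm_mul, RCLike.norm_conj, mul_pow]
    have := hcoeff n
    gcongr
  have hκ : 0 < η * C := by positivity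
  -- From `L²` to `L¹` through `|G| ≤ κ / 2 + |G|² / (2κ)` with `κ = η C`.
  have hle : ∫ t, ‖G t‖ ∂(haarAddCircle (T := L)) ≤
      ∫ t, (η * C / 2 + ‖G t‖ ^ 2 * (2 * (η * C))⁻¹) ∂(haarAddCircle (T := L)) := by
    refine integral_mono hint1 ((integrable_const _).add (hint2.mul_const _)) fun t => ?_
    have h5 : η * C / 2 + ‖G t‖ ^ 2 * (2 * (η * C))⁻¹ - ‖G t‖ =
        (‖G t‖ - η * C) ^ 2 * (2 * (η * C))⁻¹ := by
      field_simp
      ring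
    have h6 : 0 ≤ (‖G t‖ - η * C) ^ 2 * (2 * (η * C))⁻¹ := by positivity
    linarith
  rw [integral_add (integrable_const _) (hint2.mul_const _), integral_mul_const] at hle
  simp only [integral_const, Measure.real, measure_univ, ENNReal.toReal_one, one_smul] at hle
  have h7 : (∫ t, ‖G t‖ ^ 2 ∂(haarAddCircle (T := L))) * (2 * (η * C))⁻¹ ≤ η * C / 2 := by
    rw [← div_eq_mul_inv, div_le_iff₀ (by positivity)]
    nlinarith
  linarith

theorem integral_haarAddCircle_eq_intervalIntegral {E : Type*} [NormedAddCommGroup E]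
    [NormedSpace ℝ E] (F : AddCircle L → E) :
    ∫ t, F t ∂(haarAddCircle (T := L)) = L⁻¹ • ∫ t in (0 : ℝ)..L, F t := by
  rw [AddCircle.integral_haarAddCircle, ← AddCircle.intervalIntegral_preimage L 0 F, zero_add]

end Circle

/-- If all Fourier integrals of `h` over `[0, L]` are small, and `L` is nearly a period of `h`,
then the autocorrelation of `h` over `[0, L]` is small in the mean. -/
theorem integral_norm_autocorrelation_interval_le {h : ℝ → ℂ} (hh : Continuous h)
    {C ε η L : ℝ} (hC : 0 < C) (hη : 0 < η) (hL : 0 < L) (hb : ∀ t, ‖h t‖ ≤ C)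
    (hper : ∀ t, ‖h (t + L) - h t‖ ≤ ε)
    (hsmall : ∀ ν, ‖∫ t in (0 : ℝ)..L, h t * realChar ν t‖ ≤ η * L) :
    ∫ t in (0 : ℝ)..L, ‖∫ s in (0 : ℝ)..L, h (s + t) * (starRingEnd ℂ) (h s)‖ ≤
      (ε + η) * C * L ^ 2 := by
  have : Fact (0 < L) := ⟨hL⟩
  -- The `L`-periodic extension of `h` from `[0, L)`; its Fourier coefficients are the integrals in
  -- `hsmall` at the frequencies `-2πn / L`, divided by `L`.
  set u : AddCircle L → ℂ := AddCircle.liftIco L 0 h with hu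
  have hε0 : 0 ≤ ε := (norm_nonneg _).trans (hper 0)
  have hum : Measurable u := by
    have : u = fun x => h (AddCircle.measurableEquivIco L 0 x : ℝ) := rfl
    rw [this]
    exact hh.measurable.comp (measurable_subtype_coe.comp
      (AddCircle.measurableEquivIco L 0).measurable)
  have hub : ∀ x, ‖u x‖ ≤ C := fun x => hb _
  have huv : ∀ x : ℝ, 0 ≤ x → x < L → u x = h x := fun x h0 h1 =>
    AddCircle.liftIco_coe_apply ⟨h0, by rwa [zero_add]⟩
  have hcoeff : ∀ n, ‖fourierCoeff u n‖ ≤ η := by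
    intro n
    unfold fourierCoeff
    rw [integral_haarAddCircle_eq_intervalIntegral, norm_smul, norm_inv,
      Real.norm_of_nonneg hL.le, inv_mul_le_iff₀ hL, mul_comm L]
    refine le_trans (le_of_eq ?_) (hsmall (-(2 * Real.pi * n / L)))
    congr 1
    refine intervalIntegral.integral_congr_Ioo_of_le hL.le fun x hx => ?_
    simp only [smul_eq_mul]
    rw [huv x hx.1.le hx.2, mul_comm, fourier_coe_apply, realChar]
    congr 2
    push_cast
    field_simp
  have hmain := integral_norm_autocorrelation_le hum hC hη hub hcoeff
  rw [integral_haarAddCircle_eq_intervalIntegral, smul_eq_mul, inv_mul_le_iff₀ hL] at hmain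
  have hum' : Measurable fun x : ℝ => u x := hum.comp AddCircle.measurable_mk'
  -- The two integrands differ only when `s + t` wraps around past `L`, and there `L` being nearly a
  -- period bounds the difference.
  have hclose : ∀ s t : ℝ, s ∈ Set.Ioo 0 L → t ∈ Set.Ioo 0 L →
      ‖h (s + t) * (starRingEnd ℂ) (h s) - u ((s : AddCircle L) + (t : AddCircle L)) *
        (starRingEnd ℂ) (u s)‖ ≤ ε * C := by
    intro s t hs ht
    rw [huv s hs.1.le hs.2, ← sub_mul, norm_mul, RCLike.norm_conj, ← AddCircle.coe_add]
    gcongr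
    · rcases lt_or_ge (s + t) L with hlt | hge
      · rw [huv (s + t) (by linarith [hs.1, ht.1]) hlt, sub_self, norm_zero]
        exact hε0
      · have h1 : ((s + t : ℝ) : AddCircle L) = ((s + t - L : ℝ) : AddCircle L) := by
          rw [AddCircle.coe_sub, AddCircle.coe_period, sub_zero]
        rw [h1, huv (s + t - L) (by linarith) (by linarith [hs.2, ht.2])]
        have := hper (s + t - L)
        rwa [sub_add_cancel] at this
    · exact hb s
  have hA : Continuous fun t => ∫ s in (0 : ℝ)..L, h (s + t) * (starRingEnd ℂ) (h s) :=
    intervalIntegral.continuous_parametric_intervalIntegral_of_continuous'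
      (f := fun t s => h (s + t) * (starRingEnd ℂ) (h s))
      ((hh.comp (continuous_snd.add continuous_fst)).mul
        (Complex.continuous_conj.comp (hh.comp continuous_snd))) _ _
  set G : AddCircle L → ℂ := fun t => ∫ s, u (s + t) * (starRingEnd ℂ) (u s)
    ∂(AddCircle.haarAddCircle (T := L)) with hG
  have hGm : MeasureTheory.StronglyMeasurable G := by
    have hm : Measurable (Function.uncurry fun (t s : AddCircle L) =>
        u (s + t) * (starRingEnd ℂ) (u s)) := by
      refine Measurable.mul ?_ ?_
      · exact hum.comp (measurable_snd.add measurable_fst)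
      · exact Complex.continuous_conj.measurable.comp (hum.comp measurable_snd)
    exact hm.stronglyMeasurable.integral_prod_right
  have hGb : ∀ t, ‖G t‖ ≤ C * C := by
    intro t
    have := MeasureTheory.norm_integral_le_of_norm_le_const
      (μ := AddCircle.haarAddCircle (T := L))
      (f := fun s => u (s + t) * (starRingEnd ℂ) (u s)) (C := C * C)
      (Eventually.of_forall fun s => by
        rw [norm_mul, RCLike.norm_conj]
        gcongr
        · exact hub _
        · exact hub _)
    simpa using this
  have hGint : IntervalIntegrable (fun t : ℝ => ‖G t‖) MeasureTheory.volume 0 L := by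
    rw [intervalIntegrable_iff]
    refine MeasureTheory.Measure.integrableOn_of_bounded (M := C * C) (by simp) ?_ ?_
    · exact (hGm.comp_measurable AddCircle.measurable_mk').norm.aestronglyMeasurable
    · exact Eventually.of_forall fun t => by rw [norm_norm]; exact hGb _
  have hpt : ∀ t ∈ Set.Ioo 0 L, ‖∫ s in (0 : ℝ)..L, h (s + t) * (starRingEnd ℂ) (h s)‖ ≤
      L * ‖G t‖ + ε * C * L := by
    intro t ht
    have h1 : (L : ℂ) * G t = ∫ s in (0 : ℝ)..L, u ((s : AddCircle L) + (t : AddCircle L)) *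
        (starRingEnd ℂ) (u s) := by
      simp only [hG]
      rw [integral_haarAddCircle_eq_intervalIntegral, Complex.real_smul, ← mul_assoc]
      push_cast
      rw [mul_inv_cancel₀ (by exact_mod_cast hL.ne'), one_mul]
    have hi1 : IntervalIntegrable (fun s => h (s + t) * (starRingEnd ℂ) (h s))
        MeasureTheory.volume 0 L := by
      apply Continuous.intervalIntegrable
      exact (hh.comp (continuous_add_const t)).mul (Complex.continuous_conj.comp hh)
    have hi2 : IntervalIntegrable (fun s : ℝ => u ((s : AddCircle L) + (t : AddCircle L)) *
        (starRingEnd ℂ) (u s)) MeasureTheory.volume 0 L := by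
      rw [intervalIntegrable_iff]
      refine MeasureTheory.Measure.integrableOn_of_bounded (M := C * C) (by simp) ?_ ?_
      · refine Measurable.aestronglyMeasurable ?_
        exact (hum.comp (AddCircle.measurable_mk'.add_const _)).mul
          (Complex.continuous_conj.measurable.comp hum')
      · exact Eventually.of_forall fun s => by
          rw [norm_mul, RCLike.norm_conj]
          gcongr
          · exact hub _
          · exact hub _
    have h2 : ‖(∫ s in (0 : ℝ)..L, h (s + t) * (starRingEnd ℂ) (h s)) - L * G t‖ ≤ ε * C * L := by
      rw [h1, ← intervalIntegral.integral_sub hi1 hi2]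
      have := intervalIntegral.norm_integral_le_of_norm_le_const_ae (a := 0) (b := L)
        (f := fun s : ℝ => h (s + t) * (starRingEnd ℂ) (h s) -
          u ((s : AddCircle L) + (t : AddCircle L)) * (starRingEnd ℂ) (u s)) (C := ε * C) ?_
      · rwa [sub_zero, abs_of_pos hL] at this
      · have : ∀ᵐ x : ℝ, x ≠ L := by simp [MeasureTheory.ae_iff]
        filter_upwards [this] with x hx hx'
        rw [Set.uIoc_of_le hL.le] at hx'
        exact hclose x t ⟨hx'.1, lt_of_le_of_ne hx'.2 hx⟩ ht
    have h3 := norm_add_le ((∫ s in (0 : ℝ)..L, h (s + t) * (starRingEnd ℂ) (h s)) - L * G t)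
      (L * G t)
    rw [sub_add_cancel, norm_mul, Complex.norm_real, Real.norm_of_nonneg hL.le] at h3
    linarith
  have hle := intervalIntegral.integral_mono_on_of_le_Ioo hL.le
    (hA.norm.intervalIntegrable (μ := MeasureTheory.volume) _ _)
    ((hGint.const_mul L).add intervalIntegrable_const) hpt
  rw [intervalIntegral.integral_add (hGint.const_mul L) intervalIntegrable_const,
    intervalIntegral.integral_const_mul, intervalIntegral.integral_const, sub_zero,
    smul_eq_mul] at hle
  have : L * (∫ t in (0 : ℝ)..L, ‖G t‖) ≤ L * (L * (η * C)) := by gcongr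
  linarith

/-! ### The uniqueness theorem -/

namespace AlmostPeriodic

variable {h : ℝ → ℂ}

/-- Riemann–Lebesgue argument: a shift by the half period `π / ν` reverses the sign of the character
and, for large `|ν|`, hardly changes `h`. -/
theorem fourierIntegral_small_of_large (hh : AlmostPeriodic h) {η : ℝ} (hη : 0 < η) :
    ∃ R T₀ : ℝ, 0 < T₀ ∧ ∀ T, T₀ ≤ T → ∀ ν : ℝ, R ≤ |ν| →
      ‖∫ t in (0 : ℝ)..T, h t * realChar ν t‖ ≤ η * T := by
  obtain ⟨C, hC, hC'⟩ := hh.bounded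
  obtain ⟨δ, hδ, hδ'⟩ := hh.uniform_continuous hη
  have hpi := Real.pi_pos
  refine ⟨Real.pi / δ, 2 * C * δ / η, by positivity, fun T hT ν hν => ?_⟩
  have hν0 : 0 < |ν| := lt_of_lt_of_le (by positivity) hν
  have hνne : ν ≠ 0 := abs_pos.1 hν0
  have hT0 : 0 ≤ T := le_trans (by positivity) hT
  rw [div_le_iff₀ hη] at hT
  set x := Real.pi / ν with hx
  have hxδ : |x| ≤ δ := by
    rw [hx, abs_div, abs_of_pos hpi, div_le_iff₀ hν0]
    rw [div_le_iff₀ hδ] at hν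
    linarith
  have hchar : realChar ν x = -1 := by
    rw [realChar, hx, mul_div_cancel₀ _ hνne, mul_comm, Complex.exp_pi_mul_I]
  set k : ℝ → ℂ := fun t => h t * realChar ν t with hk
  have hkc : Continuous k := hh.1.mul (continuous_realChar ν)
  have hkC : ∀ t, ‖k t‖ ≤ C := fun t => by
    rw [hk]
    simp only [norm_mul, norm_realChar, mul_one]
    exact hC' t
  have e1 := norm_integral_translate_sub_le hkc hkC x T
  have e2 := norm_integral_sub_le_of_norm_sub_le (u := k) (v := fun t => -k (x + t)) hkc
    (hkc.comp (continuous_const_add x)).neg hT0 (ε := η) (fun t => by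
      have : k t - -k (x + t) = -((h (t + x) - h t) * realChar ν t) := by
        simp only [hk]
        rw [realChar_add_right, hchar, add_comm x t]
        ring
      rw [this, norm_neg, norm_mul, norm_realChar, mul_one]
      exact hδ' t x hxδ)
  rw [intervalIntegral.integral_neg, sub_neg_eq_add] at e2
  have e3 : (2 : ℂ) * (∫ t in (0 : ℝ)..T, k t) =
      ((∫ t in (0 : ℝ)..T, k t) + ∫ t in (0 : ℝ)..T, k (x + t)) -
      ((∫ t in (0 : ℝ)..T, k (x + t)) - ∫ t in (0 : ℝ)..T, k t) := by ring
  have e4 := norm_sub_le ((∫ t in (0 : ℝ)..T, k t) + ∫ t in (0 : ℝ)..T, k (x + t))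
    ((∫ t in (0 : ℝ)..T, k (x + t)) - ∫ t in (0 : ℝ)..T, k t)
  rw [← e3, norm_mul, Complex.norm_ofNat] at e4
  have : C * |x| ≤ C * δ := by gcongr
  change ‖∫ t in (0 : ℝ)..T, k t‖ ≤ η * T
  linarith

/-- On a window of fixed length `S` the characters of frequency `ν` and `ν₀` agree nearly up to a
constant phase, so the vanishing mean at `ν₀` makes every window integral small. Averaging over the
position of the window reaches `[0, T]`. -/
theorem fourierIntegral_small_near (hh : AlmostPeriodic h) {ν₀ : ℝ}
    (hmean : HasMean (fun t => h t * realChar ν₀ t) 0) {η : ℝ} (hη : 0 < η) :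
    ∃ r : ℝ, 0 < r ∧ ∃ T₀ : ℝ, 0 < T₀ ∧ ∀ T, T₀ ≤ T → ∀ ν : ℝ, |ν - ν₀| ≤ r →
      ‖∫ t in (0 : ℝ)..T, h t * realChar ν t‖ ≤ η * T := by
  obtain ⟨C, hC, hC'⟩ := hh.bounded
  obtain ⟨S, hS, hS'⟩ := hmean (η / 4) (by positivity)
  refine ⟨η / (4 * S * C), by positivity, 4 * C * S / η, by positivity, fun T hT ν hν => ?_⟩
  have hT0 : 0 < T := lt_of_lt_of_le (by positivity) hT
  rw [div_le_iff₀ hη] at hT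
  rw [le_div_iff₀ (by positivity)] at hν
  set k : ℝ → ℂ := fun t => h t * realChar ν t with hk
  have hkc : Continuous k := hh.1.mul (continuous_realChar ν)
  have hkC : ∀ t, ‖k t‖ ≤ C := fun t => by
    rw [hk]
    simp only [norm_mul, norm_realChar, mul_one]
    exact hC' t
  have hshort : ∀ x, ‖∫ t in (0 : ℝ)..S, k (x + t)‖ ≤ η / 2 * S := by
    intro x
    have e0 := hS' S le_rfl x
    rw [mul_zero, sub_zero] at e0
    have e1 : ‖(∫ t in (0 : ℝ)..S, k (x + t)) - ∫ t in (0 : ℝ)..S, realChar (ν - ν₀) x *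
        (h (x + t) * realChar ν₀ (x + t))‖ ≤ η / 4 * |S - 0| := by
      rw [← intervalIntegral.integral_sub]
      · refine intervalIntegral.norm_integral_le_of_norm_le_const fun t ht => ?_
        rw [Set.uIoc_of_le hS.le] at ht
        have : k (x + t) - realChar (ν - ν₀) x * (h (x + t) * realChar ν₀ (x + t)) =
            h (x + t) * realChar ν₀ (x + t) * realChar (ν - ν₀) x *
              (realChar (ν - ν₀) t - 1) := by
          simp only [hk]
          have : realChar ν (x + t) = realChar (ν - ν₀) (x + t) * realChar ν₀ (x + t) := by
            rw [← realChar_add_left, sub_add_cancel]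
          rw [this, realChar_add_right (ν - ν₀)]
          ring
        rw [this, norm_mul, norm_mul, norm_mul, norm_realChar, norm_realChar, mul_one, mul_one]
        have e2 := norm_realChar_sub_one_le (ν - ν₀) t
        rw [abs_mul, abs_of_pos ht.1] at e2
        calc _ ≤ C * (|ν - ν₀| * S) := by
              gcongr
              · exact hC' _
              · exact e2.trans (by gcongr; exact ht.2)
          _ ≤ η / 4 := by linarith
      · exact (hkc.comp (continuous_const_add x)).intervalIntegrable _ _
      · apply Continuous.intervalIntegrable
        exact continuous_const.mul ((hh.1.comp (continuous_const_add x)).mul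
          ((continuous_realChar ν₀).comp (continuous_const_add x)))
    rw [intervalIntegral.integral_const_mul, sub_zero, abs_of_pos hS] at e1
    have e3 := norm_add_le ((∫ t in (0 : ℝ)..S, k (x + t)) - realChar (ν - ν₀) x *
      ∫ t in (0 : ℝ)..S, (h (x + t) * realChar ν₀ (x + t))) (realChar (ν - ν₀) x *
      ∫ t in (0 : ℝ)..S, (h (x + t) * realChar ν₀ (x + t)))
    rw [sub_add_cancel, norm_mul, norm_realChar, one_mul] at e3
    linarith
  have hcont : Continuous (Function.uncurry fun x t => k (x + t)) :=
    hkc.comp (continuous_fst.add continuous_snd)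
  have hswap := intervalIntegral_swap_of_continuous hcont hT0.le hS.le
  have e4 : ‖∫ x in (0 : ℝ)..T, ∫ t in (0 : ℝ)..S, k (x + t)‖ ≤ η / 2 * S * |T - 0| :=
    intervalIntegral.norm_integral_le_of_norm_le_const fun x _ => hshort x
  have hcont2 : Continuous fun t => ∫ x in (0 : ℝ)..T, k (x + t) :=
    intervalIntegral.continuous_parametric_intervalIntegral_of_continuous'
      (f := fun t x => k (x + t)) (hkc.comp (continuous_snd.add continuous_fst)) _ _
  have e5 : ‖(∫ t in (0 : ℝ)..S, ∫ x in (0 : ℝ)..T, k (x + t)) -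
      ∫ t in (0 : ℝ)..S, ∫ x in (0 : ℝ)..T, k x‖ ≤ 2 * C * S * |S - 0| := by
    rw [← intervalIntegral.integral_sub (hcont2.intervalIntegrable _ _)
      intervalIntegrable_const]
    refine intervalIntegral.norm_integral_le_of_norm_le_const fun t ht => ?_
    rw [Set.uIoc_of_le hS.le] at ht
    have := norm_integral_translate_sub_le hkc hkC t T
    simp only [add_comm t] at this
    refine this.trans ?_
    rw [abs_of_pos ht.1]
    gcongr
    exact ht.2
  rw [hswap, sub_zero, abs_of_pos hT0] at e4
  rw [intervalIntegral.integral_const, sub_zero, abs_of_pos hS] at e5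
  have e6 := norm_sub_le (∫ t in (0 : ℝ)..S, ∫ x in (0 : ℝ)..T, k (x + t))
    ((∫ t in (0 : ℝ)..S, ∫ x in (0 : ℝ)..T, k (x + t)) - S • ∫ x in (0 : ℝ)..T, k x)
  rw [sub_sub_cancel, norm_smul, Real.norm_of_nonneg hS.le] at e6
  have e7 : S * ‖∫ x in (0 : ℝ)..T, k x‖ ≤ S * (η * T) := by nlinarith
  exact le_of_mul_le_mul_left e7 hS

/-- Compactness handles bounded `ν`. One threshold must serve all `ν`, since the frequencies `2πn /
L` on the circle change with `L`. -/
theorem fourierIntegral_small (hh : AlmostPeriodic h)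
    (hmean : ∀ ν, HasMean (fun t => h t * realChar ν t) 0) {η : ℝ} (hη : 0 < η) :
    ∃ T₀ : ℝ, 0 < T₀ ∧ ∀ T, T₀ ≤ T → ∀ ν : ℝ,
      ‖∫ t in (0 : ℝ)..T, h t * realChar ν t‖ ≤ η * T := by
  obtain ⟨R, T₁, hT₁, H₁⟩ := hh.fourierIntegral_small_of_large hη
  obtain ⟨T₂, hT₂, H₂⟩ : ∃ T₀ : ℝ, 0 < T₀ ∧ ∀ T, T₀ ≤ T → ∀ ν ∈ Set.Icc (-R) R,
      ‖∫ t in (0 : ℝ)..T, h t * realChar ν t‖ ≤ η * T := by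
    refine (isCompact_Icc (a := -R) (b := R)).induction_on
      (p := fun U => ∃ T₀ : ℝ, 0 < T₀ ∧ ∀ T, T₀ ≤ T → ∀ ν ∈ U,
        ‖∫ t in (0 : ℝ)..T, h t * realChar ν t‖ ≤ η * T) ?_ ?_ ?_ ?_
    · exact ⟨1, one_pos, fun _ _ _ h => h.elim⟩
    · rintro s t hst ⟨T, hT, H⟩
      exact ⟨T, hT, fun T' h1 ν h2 => H T' h1 ν (hst h2)⟩
    · rintro s t ⟨T, hT, H⟩ ⟨T', hT', H'⟩
      refine ⟨max T T', hT.trans_le (le_max_left _ _), fun X hX ν hν => ?_⟩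
      rcases hν with hν | hν
      · exact H X ((le_max_left _ _).trans hX) ν hν
      · exact H' X ((le_max_right _ _).trans hX) ν hν
    · intro ν₀ _
      obtain ⟨r, hr, T, hT, H⟩ := hh.fourierIntegral_small_near (hmean ν₀) hη
      refine ⟨Metric.closedBall ν₀ r,
        mem_nhdsWithin_of_mem_nhds (Metric.closedBall_mem_nhds _ hr), T, hT, fun X hX ν hν => ?_⟩
      exact H X hX ν (by rwa [Metric.mem_closedBall, Real.dist_eq] at hν)
  refine ⟨max T₁ T₂, hT₁.trans_le (le_max_left _ _), fun T hT ν => ?_⟩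
  rcases le_total R |ν| with hν | hν
  · exact H₁ T ((le_max_left _ _).trans hT) ν hν
  · exact H₂ T ((le_max_right _ _).trans hT) ν (abs_le.1 hν)

/-- For a finite net `S` of translates, `|h t₀|² ≤ ε + ∑ r ∈ S, |h (x + t₀ - r)|²` at every `x`.
Taking the mean in `x` leaves only `ε`. -/
theorem eq_zero_of_hasMean_sq (hh : AlmostPeriodic h)
    (hmean : HasMean (fun t => h t * (starRingEnd ℂ) (h t)) 0) (t₀ : ℝ) : h t₀ = 0 := by
  have hq := hh.mul hh.star
  have hqn : ∀ t, ‖h t * (starRingEnd ℂ) (h t)‖ = ‖h t‖ ^ 2 := fun t => by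
    rw [norm_mul, RCLike.norm_conj, sq]
  suffices ‖h t₀ * (starRingEnd ℂ) (h t₀)‖ ≤ 0 by
    rw [hqn] at this
    exact norm_eq_zero.1 (pow_eq_zero_iff two_ne_zero |>.1 (le_antisymm this (sq_nonneg _)))
  refine le_of_forall_pos_le_add fun ε hε => ?_
  obtain ⟨S, -, hS⟩ := hq.exists_net hε
  have hle := (HasMean.const (h t₀ * (starRingEnd ℂ) (h t₀))).norm_le
    (k := fun x => ε + ∑ r ∈ S, ‖h (x + (t₀ - r))‖ ^ 2) (K := ε) (by
      have := hh.1
      fun_prop) (by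
      have h1 := HasMean.sum S
        (h := fun r x => h (x + (t₀ - r)) * (starRingEnd ℂ) (h (x + (t₀ - r))))
        (m := fun _ => 0)
        (fun r _ => hq.1.comp (continuous_add_const (t₀ - r)))
        (fun r _ => hmean.translate (t₀ - r))
      have h2 := HasMean.add continuous_const (continuous_finsetSum _ fun r _ =>
        hq.1.comp (continuous_add_const (t₀ - r))) (HasMean.const (ε : ℂ)) h1
      simp only [Finset.sum_const_zero, add_zero] at h2
      convert h2 using 2 with x
      push_cast
      congr 1
      refine Finset.sum_congr rfl fun r _ => ?_
      simp only [Function.comp_apply]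
      rw [Complex.mul_conj, Complex.normSq_eq_norm_sq]
      push_cast
      rfl) (fun x => by
      obtain ⟨r, hr, hrt⟩ := hS x
      have h3 := hrt (t₀ - r)
      rw [sub_add_cancel, norm_sub_rev] at h3
      have h4 := norm_add_le (h t₀ * (starRingEnd ℂ) (h t₀) - h (t₀ - r + x) *
        (starRingEnd ℂ) (h (t₀ - r + x))) (h (t₀ - r + x) * (starRingEnd ℂ) (h (t₀ - r + x)))
      rw [sub_add_cancel, hqn (t₀ - r + x), add_comm (t₀ - r) x] at h4
      rw [add_comm (t₀ - r) x] at h3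
      have h5 := Finset.single_le_sum (f := fun r => ‖h (x + (t₀ - r))‖ ^ 2)
        (fun _ _ => sq_nonneg _) hr
      linarith)
  linarith

/-- **Uniqueness theorem** for almost periodic functions. -/
theorem eq_zero_of_fourier_zero (hh : AlmostPeriodic h)
    (hmean : ∀ ν, HasMean (fun t => h t * realChar ν t) 0) (t₀ : ℝ) : h t₀ = 0 := by
  refine hh.eq_zero_of_hasMean_sq ?_ t₀
  obtain ⟨m, hm⟩ := (hh.mul hh.star).exists_mean
  suffices ‖m‖ ≤ 0 by rwa [norm_le_zero_iff.1 this] at hm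
  obtain ⟨C, hC, hC'⟩ := hh.bounded
  refine le_of_forall_pos_le_add fun κ' hκ' => ?_
  -- Of the five `κ`, one comes from the net, two from the mean of the autocorrelation, one from
  -- shifting it by the net, and one from replacing the mean `m` by an average over `[0, L]`.
  set κ := κ' / 5 with hκdef
  have hκ : 0 < κ := by positivity
  obtain ⟨S, -, hS⟩ := hh.exists_net (ε := κ / C) (by positivity)
  set k : ℝ := (Finset.card S : ℝ) with hk
  have hk0 : 0 ≤ k := Nat.cast_nonneg _
  set η := κ / ((k + 1) * C) with hη
  have hη0 : 0 < η := by positivity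
  obtain ⟨T₁, hT₁, H₁⟩ := hh.fourierIntegral_small hmean hη0
  obtain ⟨T₂, hT₂, H₂⟩ := hm κ hκ
  -- `L` is a translation number beyond all thresholds, so that `[0, L]` can be closed to a circle.
  -- The last entry of the maximum makes the cost of the shifts by `r ∈ S` at most `κ L²`.
  obtain ⟨L, hL, hL0, hper⟩ := hh.exists_large_translation hη0
    (max (max T₁ T₂) (2 * C ^ 2 * (∑ r ∈ S, |r|) / κ))
  have hL1 := ((le_max_left _ _).trans (le_max_left _ _)).trans hL
  have hL2 := ((le_max_right _ _).trans (le_max_left _ _)).trans hL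
  have hL3 := (le_max_right _ _).trans hL
  rw [div_le_iff₀ hκ] at hL3
  set A : ℝ → ℂ := fun t => ∫ s in (0 : ℝ)..L, h (s + t) * (starRingEnd ℂ) (h s) with hA
  have hAc : Continuous A :=
    intervalIntegral.continuous_parametric_intervalIntegral_of_continuous'
      (f := fun t s => h (s + t) * (starRingEnd ℂ) (h s))
      ((hh.1.comp (continuous_snd.add continuous_fst)).mul
        (Complex.continuous_conj.comp (hh.1.comp continuous_snd))) _ _
  have hAb : ∀ t, ‖A t‖ ≤ C * C * L := by
    intro t
    have : ‖A t‖ ≤ C * C * |L - 0| :=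
      intervalIntegral.norm_integral_le_of_norm_le_const fun s _ => by
        rw [norm_mul, RCLike.norm_conj]
        gcongr
        · exact hC' _
        · exact hC' _
    rwa [sub_zero, abs_of_pos hL0] at this
  have hAint : ∫ t in (0 : ℝ)..L, ‖A t‖ ≤ (η + η) * C * L ^ 2 :=
    integral_norm_autocorrelation_interval_le hh.1 hC hη0 hL0 hC' hper (H₁ L hL1)
  -- The autocorrelation is small only in the mean over `t`, whereas its value at `0` is wanted.
  -- Almost periodicity bounds that value by a finite sum of shifts, at every `t`.
  have hA0 : ∀ t, ‖A 0‖ ≤ κ * L + ∑ r ∈ S, ‖A (-r + t)‖ := by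
    intro t
    obtain ⟨r, hr, hrt⟩ := hS t
    have h1 : ‖A (-r + t) - A 0‖ ≤ κ / C * C * L := by
      refine norm_integral_sub_le_of_norm_sub_le
        ((hh.1.comp (continuous_add_const _)).mul (Complex.continuous_conj.comp hh.1))
        ((hh.1.comp (continuous_add_const _)).mul (Complex.continuous_conj.comp hh.1))
        hL0.le fun s => ?_
      simp only [Pi.mul_apply, Function.comp_apply]
      rw [← sub_mul, norm_mul, RCLike.norm_conj]
      have h2 := hrt (s - r)
      rw [sub_add_cancel, show s - r + t = s + (-r + t) by ring] at h2
      rw [add_zero]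
      gcongr
      exact hC' s
    rw [div_mul_cancel₀ _ hC.ne'] at h1
    have h3 := norm_sub_le (A (-r + t)) (A (-r + t) - A 0)
    rw [sub_sub_cancel] at h3
    have h4 := Finset.single_le_sum (f := fun r => ‖A (-r + t)‖) (fun _ _ => norm_nonneg _) hr
    linarith
  have hshift : ∀ r ∈ S, ∫ t in (0 : ℝ)..L, ‖A (-r + t)‖ ≤
      (η + η) * C * L ^ 2 + 2 * (C * C * L) * |r| := by
    intro r _
    have := norm_integral_translate_sub_le (u := fun t => ‖A t‖) hAc.norm
      (C := C * C * L) (fun t => by rw [norm_norm]; exact hAb t) (-r) L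
    rw [Real.norm_eq_abs, abs_neg] at this
    have := (abs_le.1 this).2
    linarith
  have hci : ∀ r, Continuous fun t => ‖A (-r + t)‖ := fun r =>
    (hAc.comp (continuous_const_add (-r))).norm
  have hcs : Continuous fun t => κ * L + ∑ r ∈ S, ‖A (-r + t)‖ :=
    continuous_const.add (continuous_finsetSum S fun r _ => hci r)
  have hint := intervalIntegral.integral_mono_on hL0.le
    (intervalIntegrable_const (c := ‖A 0‖) (μ := MeasureTheory.volume))
    (hcs.intervalIntegrable 0 L)
    (fun t _ => hA0 t)
  rw [intervalIntegral.integral_add intervalIntegrable_const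
    ((continuous_finsetSum S fun r _ => hci r).intervalIntegrable 0 L),
    intervalIntegral.integral_finsetSum fun r _ => (hci r).intervalIntegrable 0 L,
    intervalIntegral.integral_const, intervalIntegral.integral_const, sub_zero, smul_eq_mul,
    smul_eq_mul] at hint
  have hsum : ∑ r ∈ S, ∫ t in (0 : ℝ)..L, ‖A (-r + t)‖ ≤
      k * ((η + η) * C * L ^ 2) + 2 * (C * C * L) * ∑ r ∈ S, |r| := by
    refine (Finset.sum_le_sum hshift).trans (le_of_eq ?_)
    rw [Finset.sum_add_distrib, Finset.sum_const, nsmul_eq_mul, Finset.mul_sum]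
  have hkη : k * (η * C) ≤ κ := by
    have : k * (η * C) = k / (k + 1) * κ := by
      rw [hη]
      field_simp
    rw [this]
    exact mul_le_of_le_one_left hκ.le ((div_le_one (by positivity)).2 (by linarith))
  have hfin : L * ‖A 0‖ ≤ L * (4 * κ * L) := by
    have h6 : k * ((η + η) * C * L ^ 2) ≤ 2 * κ * L ^ 2 := by
      have : k * ((η + η) * C * L ^ 2) = 2 * (k * (η * C)) * L ^ 2 := by ring
      rw [this]
      gcongr
    have h7 : 2 * (C * C * L) * ∑ r ∈ S, |r| ≤ κ * L ^ 2 := by nlinarith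
    nlinarith
  have hfin' := le_of_mul_le_mul_left hfin hL0
  have hmA := H₂ L hL2 0
  simp only [zero_add] at hmA
  have h8 : A 0 = ∫ t in (0 : ℝ)..L, h t * (starRingEnd ℂ) (h t) := by
    simp only [hA, add_zero]
  rw [← h8] at hmA
  have h9 := norm_sub_le (A 0) (A 0 - L * m)
  rw [sub_sub_cancel, norm_mul, Complex.norm_real, Real.norm_of_nonneg hL0.le] at h9
  have h10 : L * ‖m‖ ≤ L * (5 * κ) := by linarith
  have := le_of_mul_le_mul_left h10 hL0
  rw [hκdef] at this
  linarith

end AlmostPeriodic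

/-! ### Absolutely convergent series of characters -/

namespace AlmostPeriodic

theorem add {h g : ℝ → ℂ} (hh : AlmostPeriodic h) (hg : AlmostPeriodic g) :
    AlmostPeriodic (fun t => h t + g t) := by
  simpa using hh.sub ((const 0).sub hg)

theorem sum {ι : Type*} (s : Finset ι) {h : ι → ℝ → ℂ} (hh : ∀ i ∈ s, AlmostPeriodic (h i)) :
    AlmostPeriodic (fun t => ∑ i ∈ s, h i t) := by
  classical
  induction s using Finset.induction_on with
  | empty => simpa using const 0
  | insert a s ha ih =>
    simp only [Finset.sum_insert ha]
    exact (hh a (Finset.mem_insert_self _ _)).add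
      (ih fun i hi => hh i (Finset.mem_insert_of_mem hi))

theorem of_approx {h : ℝ → ℂ} (hc : Continuous h)
    (H : ∀ ε : ℝ, 0 < ε → ∃ g, AlmostPeriodic g ∧ ∀ t, ‖h t - g t‖ ≤ ε) : AlmostPeriodic h := by
  refine ⟨hc, fun ε hε => ?_⟩
  obtain ⟨g, hg, hhg⟩ := H (ε / 3) (by positivity)
  obtain ⟨n, c, hcl⟩ := hg.2 (ε / 3) (by positivity)
  refine ⟨n, c, fun τ τ' hτ t => ?_⟩
  have : h (t + τ) - h (t + τ') = (h (t + τ) - g (t + τ)) - (h (t + τ') - g (t + τ')) +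
    (g (t + τ) - g (t + τ')) := by ring
  rw [this]
  calc _ ≤ ‖h (t + τ) - g (t + τ)‖ + ‖h (t + τ') - g (t + τ')‖ + ‖g (t + τ) - g (t + τ')‖ :=
        (norm_add_le _ _).trans (add_le_add_left (norm_sub_le _ _) _)
    _ ≤ ε := by linarith [hhg (t + τ), hhg (t + τ'), hcl τ τ' hτ t]

end AlmostPeriodic

/-- One finite set serves all families dominated by `D`; this gives approximations uniform in `t` or
in `s`. -/
theorem exists_finset_norm_tsum_sub_le {ι : Type*} {D : ι → ℝ} (hD : Summable D)
    {ε : ℝ} (hε : 0 < ε) : ∃ F : Finset ι, ∀ F' : Finset ι, F ⊆ F' → ∀ v : ι → ℂ,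
      (∀ i, ‖v i‖ ≤ D i) → ‖(∑' i, v i) - ∑ i ∈ F', v i‖ ≤ ε := by
  classical
  have hlim := hD.hasSum
  rw [HasSum, SummationFilter.unconditional_filter, Metric.tendsto_atTop] at hlim
  obtain ⟨F, hF⟩ := hlim ε hε
  refine ⟨F, fun F' hF' v hle => ?_⟩
  have hv : Summable fun i => ‖v i‖ := hD.of_nonneg_of_le (fun _ => norm_nonneg _) hle
  have h1 := hF F' hF'
  rw [dist_comm, Real.dist_eq, ← hD.sum_add_tsum_subtype_compl F', add_sub_cancel_left] at h1
  rw [← hv.of_norm.sum_add_tsum_subtype_compl F', add_sub_cancel_left]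
  have hv' : Summable fun i : {i // i ∉ F'} => ‖v i‖ := hv.subtype _
  have hD' : Summable fun i : {i // i ∉ F'} => D i := hD.subtype _
  have h2 : ‖∑' i : {i // i ∉ F'}, v i‖ ≤ ∑' i : {i // i ∉ F'}, ‖v i‖ := norm_tsum_le_tsum_norm hv'
  have h3 : ∑' i : {i // i ∉ F'}, ‖v i‖ ≤ ∑' i : {i // i ∉ F'}, D i :=
    hv'.tsum_le_tsum (fun i => hle i) hD'
  exact (h2.trans h3).trans ((le_abs_self _).trans h1.le)

section Series

variable {ι : Type*} {lam : ι → ℝ} {A : ι → ℂ}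

theorem continuous_tsum_realChar (hA : Summable fun i => ‖A i‖) :
    Continuous fun t => ∑' i, A i * realChar (lam i) t := by
  refine continuous_tsum (fun i => continuous_const.mul (continuous_realChar _)) hA fun i t => ?_
  rw [norm_mul, norm_realChar, mul_one]

theorem almostPeriodic_tsum_realChar (hA : Summable fun i => ‖A i‖) :
    AlmostPeriodic fun t => ∑' i, A i * realChar (lam i) t := by
  refine AlmostPeriodic.of_approx (continuous_tsum_realChar hA) fun ε hε => ?_
  obtain ⟨F, hF⟩ := exists_finset_norm_tsum_sub_le hA hε
  refine ⟨fun t => ∑ i ∈ F, A i * realChar (lam i) t, AlmostPeriodic.sum F fun i _ =>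
    (AlmostPeriodic.const _).mul (AlmostPeriodic.char _), fun t => ?_⟩
  exact hF F subset_rfl _ fun i => by rw [norm_mul, norm_realChar, mul_one]

theorem hasMean_tsum_realChar (hlam : Function.Injective lam) (hA : Summable fun i => ‖A i‖)
    {a : ℝ → ℂ} (ha : ∀ i, a (lam i) = A i) (ha0 : ∀ ν, ν ∉ Set.range lam → a ν = 0) (ν : ℝ) :
    HasMean (fun t => (∑' i, A i * realChar (lam i) t) * realChar (-ν) t) (a ν) := by
  classical
  refine HasMean.of_approx ((continuous_tsum_realChar hA).mul (continuous_realChar _))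
    fun ε hε => ?_
  obtain ⟨F, hF⟩ := exists_finset_norm_tsum_sub_le hA hε
  -- Including the index of `ν`, if there is one, makes the mean of the partial sum exactly `a ν`.
  obtain ⟨F', hFF', hF'⟩ : ∃ F' : Finset ι, F ⊆ F' ∧ ∀ i, lam i = ν → i ∈ F' := by
    by_cases hν : ν ∈ Set.range lam
    · obtain ⟨j, hj⟩ := hν
      refine ⟨insert j F, Finset.subset_insert _ _, fun i hi => ?_⟩
      rw [hlam (hi.trans hj.symm)]
      exact Finset.mem_insert_self _ _
    · exact ⟨F, subset_rfl, fun i hi => (hν ⟨i, hi⟩).elim⟩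
  have hsum := HasMean.sum F' (h := fun i t => A i * realChar (lam i + -ν) t)
    (fun i _ => continuous_const.mul (continuous_realChar _))
    (fun i _ => (HasMean.char (lam i + -ν)).const_mul (A i))
  have hval : (∑ i ∈ F', A i * if lam i + -ν = 0 then (1 : ℂ) else 0) = a ν := by
    by_cases hν : ν ∈ Set.range lam
    · obtain ⟨j, hj⟩ := hν
      rw [Finset.sum_eq_single j]
      · simp [← hj, ha]
      · intro i _ hij
        rw [if_neg, mul_zero]
        rw [← hj, ← sub_eq_add_neg, sub_eq_zero]
        exact fun h => hij (hlam h)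
      · intro h
        exact (h (hF' j hj)).elim
    · rw [ha0 ν hν]
      refine Finset.sum_eq_zero fun i _ => ?_
      rw [if_neg, mul_zero]
      rw [← sub_eq_add_neg, sub_eq_zero]
      exact fun h => hν ⟨i, h⟩
  rw [hval] at hsum
  refine ⟨_, a ν, ?_, hsum, fun t => ?_, by simpa using hε.le⟩
  · exact continuous_finsetSum _ fun i _ => continuous_const.mul (continuous_realChar _)
  · have : ∑ i ∈ F', A i * realChar (lam i + -ν) t =
        (∑ i ∈ F', A i * realChar (lam i) t) * realChar (-ν) t := by
      rw [Finset.sum_mul]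
      exact Finset.sum_congr rfl fun i _ => by rw [realChar_add_left]; ring
    rw [this, ← sub_mul, norm_mul, norm_realChar, mul_one]
    exact hF F' hFF' _ fun i => by rw [norm_mul, norm_realChar, mul_one]

theorem AlmostPeriodic.eq_tsum_realChar {h : ℝ → ℂ} (hh : AlmostPeriodic h)
    (hlam : Function.Injective lam) (hA : Summable fun i => ‖A i‖)
    {a : ℝ → ℂ} (ha : ∀ i, a (lam i) = A i) (ha0 : ∀ ν, ν ∉ Set.range lam → a ν = 0)
    (hmean : ∀ ν, HasMean (fun t => h t * realChar (-ν) t) (a ν)) (t : ℝ) :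
    h t = ∑' i, A i * realChar (lam i) t := by
  have hg := almostPeriodic_tsum_realChar (lam := lam) hA
  refine sub_eq_zero.1 ((hh.sub hg).eq_zero_of_fourier_zero (fun ν => ?_) t)
  have h1 := hmean (-ν)
  have h2 := hasMean_tsum_realChar hlam hA ha ha0 (-ν)
  rw [neg_neg] at h1 h2
  have h3 := HasMean.add (hh.1.mul (continuous_realChar ν))
    (continuous_const.mul (hg.1.mul (continuous_realChar ν))) h1 (h2.const_mul (-1))
  convert h3 using 2
  · simp only [Pi.mul_apply]
    ring
  · ring

end Series

/-! ### The Dirichlet series in the strip -/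

section Strip

variable {α β : EReal} {f : ℂ → ℂ}

theorem isOpen_verticalStrip (α β : EReal) : IsOpen (verticalStrip α β) := by
  have h : Continuous fun s : ℂ => (s.re : EReal) :=
    continuous_coe_real_ereal.comp Complex.continuous_re
  exact (isOpen_lt continuous_const h).inter (isOpen_lt h continuous_const)

theorem mem_verticalStrip_of_re {s : ℂ} {a b : ℝ} (ha : α < a) (hb : (b : EReal) < β)
    (h1 : a ≤ s.re) (h2 : s.re ≤ b) : s ∈ verticalStrip α β :=
  ⟨ha.trans_le (EReal.coe_le_coe_iff.2 h1), (EReal.coe_le_coe_iff.2 h2).trans_lt hb⟩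

theorem re_line (σ t : ℝ) : ((σ : ℂ) + Complex.I * t).re = σ := by simp

theorem AlmostPeriodicInStrip.line (hf : AlmostPeriodicInStrip f α β) {σ : ℝ} (h1 : α < σ)
    (h2 : (σ : EReal) < β) : AlmostPeriodic fun t => f ((σ : ℂ) + Complex.I * (t : ℂ)) := by
  refine AlmostPeriodic.of_relatively_dense ?_ fun ε hε => ?_
  · refine hf.1.continuousOn.comp_continuous (by fun_prop) fun t => ?_
    exact mem_verticalStrip_of_re h1 h2 (re_line σ t).ge (re_line σ t).le
  · obtain ⟨l, hl, H⟩ := hf.2 σ σ h1 le_rfl h2 ε hε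
    refine ⟨l, hl, fun t₀ => ?_⟩
    obtain ⟨τ, hτ, hτ'⟩ := H t₀
    refine ⟨τ, hτ, fun t => ?_⟩
    have := hτ' ((σ : ℂ) + Complex.I * t) (re_line σ t).ge (re_line σ t).le
    rwa [show (σ : ℂ) + Complex.I * t + Complex.I * τ = σ + Complex.I * ((t + τ : ℝ) : ℂ) by
      push_cast; ring] at this

theorem AlmostPeriodicInStrip.bounded (hf : AlmostPeriodicInStrip f α β) {a b : ℝ} (ha : α < a)
    (hab : a ≤ b) (hb : (b : EReal) < β) :
    ∃ C : ℝ, 0 < C ∧ ∀ s : ℂ, a ≤ s.re → s.re ≤ b → ‖f s‖ ≤ C := by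
  obtain ⟨l, hl, H⟩ := hf.2 a b ha hab hb 1 one_pos
  have hcpt : IsCompact (Set.Icc a b ×ℂ Set.Icc 0 l) := isCompact_Icc.reProdIm isCompact_Icc
  obtain ⟨C, hC⟩ := hcpt.exists_bound_of_continuousOn (f := f) (hf.1.continuousOn.mono
    fun s hs => mem_verticalStrip_of_re ha hb hs.1.1 hs.1.2)
  refine ⟨|C| + 1, by positivity, fun s h1 h2 => ?_⟩
  obtain ⟨τ, hτ, hτ'⟩ := H (-s.im)
  have e1 := hτ' s h1 h2
  have e2 := hC (s + Complex.I * τ) (by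
    rw [Complex.mem_reProdIm]
    simp only [Complex.add_re, Complex.mul_re, Complex.I_re, Complex.ofReal_re, zero_mul,
      Complex.I_im, Complex.ofReal_im, mul_zero, sub_zero, add_zero, Complex.add_im,
      Complex.mul_im, one_mul, zero_add, Set.mem_Icc]
    exact ⟨⟨h1, h2⟩, by linarith [hτ.1], by linarith [hτ.2]⟩)
  have e3 := norm_sub_le (f (s + Complex.I * τ)) (f (s + Complex.I * τ) - f s)
  rw [sub_sub_cancel] at e3
  linarith [le_abs_self C]

/-- The integrand in the definition of the Dirichlet coefficients, along a vertical line. -/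
theorem line_integrand_eq (f : ℂ → ℂ) (σ ν t : ℝ) :
    f ((σ : ℂ) + Complex.I * (t : ℂ)) *
        Complex.exp (-((ν : ℂ) * ((σ : ℂ) + Complex.I * (t : ℂ)))) =
      (Real.exp (-(σ * ν)) : ℂ) * (f ((σ : ℂ) + Complex.I * (t : ℂ)) * realChar (-ν) t) := by
  rw [mul_left_comm]
  congr 1
  rw [realChar, Complex.ofReal_exp, ← Complex.exp_add]
  congr 1
  push_cast
  ring

/-- Cauchy's theorem on a rectangle of height `T`: the horizontal sides contribute a bounded amount,
negligible against `T`. -/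
theorem hasMean_eq_of_strip (hf : AlmostPeriodicInStrip f α β) {ν a b : ℝ} (ha : α < a)
    (hab : a ≤ b) (hb : (b : EReal) < β) {m n : ℂ}
    (hm : HasMean (fun t => f ((a : ℂ) + Complex.I * (t : ℂ)) *
        Complex.exp (-((ν : ℂ) * ((a : ℂ) + Complex.I * (t : ℂ))))) m)
    (hn : HasMean (fun t => f ((b : ℂ) + Complex.I * (t : ℂ)) *
        Complex.exp (-((ν : ℂ) * ((b : ℂ) + Complex.I * (t : ℂ))))) n) : m = n := by
  obtain ⟨C, hC, hC'⟩ := hf.bounded ha hab hb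
  set F : ℂ → ℂ := fun s => f s * Complex.exp (-(ν * s)) with hF
  set D := C * Real.exp (|ν| * (|a| + |b|)) with hD
  have hD0 : 0 < D := by positivity
  have hFb : ∀ s : ℂ, a ≤ s.re → s.re ≤ b → ‖F s‖ ≤ D := by
    intro s h1 h2
    rw [hF, hD]
    simp only [norm_mul, Complex.norm_exp]
    gcongr
    · exact hC' s h1 h2
    · have : (-((ν : ℂ) * s)).re = -(ν * s.re) := by simp
      rw [this]
      have h3 : |s.re| ≤ |a| + |b| := abs_le.2
        ⟨by linarith [neg_abs_le a, abs_nonneg b], by linarith [le_abs_self b, abs_nonneg a]⟩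
      calc -(ν * s.re) ≤ |ν * s.re| := neg_le_abs _
        _ = |ν| * |s.re| := abs_mul _ _
        _ ≤ _ := by gcongr
  have hFd : DifferentiableOn ℂ F (verticalStrip α β) :=
    hf.1.mul ((Differentiable.cexp (by fun_prop)).differentiableOn)
  have hcauchy : ∀ T : ℝ, 0 < T → ‖(∫ t in (0 : ℝ)..T, F ((b : ℂ) + Complex.I * t)) -
      ∫ t in (0 : ℝ)..T, F ((a : ℂ) + Complex.I * t)‖ ≤ 2 * D * (b - a) := by
    intro T hT
    have := Complex.integral_boundary_rect_eq_zero_of_differentiableOn F (a : ℂ)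
      ((b : ℂ) + T * Complex.I) (hFd.mono fun s hs => by
        rw [Complex.mem_reProdIm] at hs
        simp only [Complex.ofReal_re, Complex.add_re, Complex.mul_re, Complex.I_re, mul_zero,
          Complex.ofReal_im, Complex.I_im, mul_one, sub_self, add_zero, Set.uIcc_of_le hab] at hs
        exact mem_verticalStrip_of_re ha hb hs.1.1 hs.1.2)
    simp only [Complex.ofReal_re, Complex.add_re, Complex.mul_re, Complex.I_re, mul_zero,
      Complex.ofReal_im, Complex.I_im, mul_one, sub_self, add_zero, Complex.add_im,
      Complex.mul_im, zero_add, Complex.ofReal_zero, zero_mul, smul_eq_mul] at this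
    have hbd : ∀ y : ℝ, ‖∫ x in a..b, F (x + y * Complex.I)‖ ≤ D * |b - a| := fun y =>
      intervalIntegral.norm_integral_le_of_norm_le_const fun x hx => by
        rw [Set.uIoc_of_le hab] at hx
        exact hFb _ (by simpa using hx.1.le) (by simpa using hx.2)
    have e1 := hbd 0
    have e2 := hbd T
    rw [abs_of_nonneg (by linarith)] at e1 e2
    simp only [Complex.ofReal_zero, zero_mul, add_zero] at e1
    simp only [mul_comm Complex.I]
    have e3 : (Complex.I : ℂ) * ((∫ t in (0 : ℝ)..T, F ((b : ℂ) + t * Complex.I)) -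
        ∫ t in (0 : ℝ)..T, F ((a : ℂ) + t * Complex.I)) =
        (∫ x in a..b, F (x + T * Complex.I)) - ∫ x in a..b, F x := by
      linear_combination this
    have e4 := norm_sub_le (∫ x in a..b, F (x + T * Complex.I)) (∫ x in a..b, F x)
    rw [← e3, norm_mul, Complex.norm_I, one_mul] at e4
    linarith
  by_contra hne
  have hpos : 0 < ‖n - m‖ := norm_pos_iff.2 (sub_ne_zero.2 (Ne.symm hne))
  obtain ⟨T₁, hT₁, H₁⟩ := hm (‖n - m‖ / 4) (by positivity)
  obtain ⟨T₂, hT₂, H₂⟩ := hn (‖n - m‖ / 4) (by positivity)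
  set T := max (max T₁ T₂) (8 * D * (b - a) / ‖n - m‖)
  have hT : 0 < T := hT₁.trans_le ((le_max_left _ _).trans (le_max_left _ _))
  have e1 := H₁ T ((le_max_left _ _).trans (le_max_left _ _)) 0
  have e2 := H₂ T ((le_max_right _ _).trans (le_max_left _ _)) 0
  have e0 : 8 * D * (b - a) / ‖n - m‖ ≤ T := le_max_right _ _
  rw [div_le_iff₀ hpos] at e0
  simp only [zero_add] at e1 e2
  have e3 := hcauchy T hT
  simp only [hF] at e3
  set X := ∫ t in (0 : ℝ)..T, f ((a : ℂ) + Complex.I * (t : ℂ)) *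
        Complex.exp (-((ν : ℂ) * ((a : ℂ) + Complex.I * (t : ℂ))))
  set Y := ∫ t in (0 : ℝ)..T, f ((b : ℂ) + Complex.I * (t : ℂ)) *
        Complex.exp (-((ν : ℂ) * ((b : ℂ) + Complex.I * (t : ℂ))))
  have e4 : (T : ℂ) * (n - m) = (Y - X) - (Y - T * n) + (X - T * m) := by ring
  have e5 : T * ‖n - m‖ ≤ ‖Y - X‖ + ‖Y - T * n‖ + ‖X - T * m‖ := by
    calc T * ‖n - m‖ = ‖(T : ℂ) * (n - m)‖ := by
          rw [norm_mul, Complex.norm_real, Real.norm_of_nonneg hT.le]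
      _ ≤ _ := by
          rw [e4]
          exact (norm_add_le _ _).trans (add_le_add_left (norm_sub_le _ _) _)
  nlinarith

theorem exists_hasMean_line (hf : AlmostPeriodicInStrip f α β) {σ : ℝ} (h1 : α < σ)
    (h2 : (σ : EReal) < β) (ν : ℝ) :
    ∃ m, HasMean (fun t => f ((σ : ℂ) + Complex.I * (t : ℂ)) *
        Complex.exp (-((ν : ℂ) * ((σ : ℂ) + Complex.I * (t : ℂ))))) m := by
  simp only [line_integrand_eq]
  exact ((AlmostPeriodic.const _).mul ((hf.line h1 h2).mul (AlmostPeriodic.char _))).exists_mean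

theorem hasMean_dirichletCoeff (hf : AlmostPeriodicInStrip f α β) {σ : ℝ} (h1 : α < σ)
    (h2 : (σ : EReal) < β) (ν : ℝ) :
    HasMean (fun t => f ((σ : ℂ) + Complex.I * (t : ℂ)) *
        Complex.exp (-((ν : ℂ) * ((σ : ℂ) + Complex.I * (t : ℂ))))) (dirichletCoeff f α β ν) := by
  obtain ⟨m, hm⟩ := exists_hasMean_line hf h1 h2 ν
  have hcoeff : IsDirichletCoeff f α β ν m := by
    intro σ' h1' h2'
    obtain ⟨n, hn⟩ := exists_hasMean_line hf h1' h2' ν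
    have : m = n := by
      rcases le_total σ σ' with h | h
      · exact hasMean_eq_of_strip hf h1 h h2' hm hn
      · exact (hasMean_eq_of_strip hf h1' h h2 hn hm).symm
    rw [this]
    exact hn.tendsto_symmetric
  have hex : ∃ c, IsDirichletCoeff f α β ν c := ⟨m, hcoeff⟩
  have : dirichletCoeff f α β ν = m := by
    rw [dirichletCoeff, dif_pos hex]
    exact tendsto_nhds_unique (hex.choose_spec σ h1 h2) hm.tendsto_symmetric
  rwa [this]

theorem hasMean_line_mul_realChar (hf : AlmostPeriodicInStrip f α β) {σ : ℝ} (h1 : α < σ)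
    (h2 : (σ : EReal) < β) (ν : ℝ) :
    HasMean (fun t => f ((σ : ℂ) + Complex.I * (t : ℂ)) * realChar (-ν) t)
      (dirichletCoeff f α β ν * Real.exp (σ * ν)) := by
  have := (hasMean_dirichletCoeff hf h1 h2 ν).const_mul (Real.exp (σ * ν) : ℂ)
  rw [mul_comm _ (dirichletCoeff f α β ν)] at this
  convert this using 2 with t
  rw [line_integrand_eq, ← mul_assoc, ← Complex.ofReal_mul, ← Real.exp_add,
    add_neg_cancel, Real.exp_zero, Complex.ofReal_one, one_mul]

theorem sum_int_mul_eq_zero {Λ : Set ℝ} (hindep : LinearIndependent ℚ (fun μ : Λ => (μ : ℝ)))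
    (F : Finset Λ) (q : F → ℤ) (hq : ∑ i, (q i : ℝ) * ((i : Λ) : ℝ) = 0) : q = 0 := by
  classical
  have h1 := hindep.comp (fun i : F => (i : Λ)) Subtype.val_injective
  rw [Fintype.linearIndependent_iff] at h1
  have h2 := h1 (fun i => (q i : ℚ)) (by
    rw [← hq]
    refine Finset.sum_congr rfl fun i _ => ?_
    rw [Rat.smul_def]
    simp)
  funext i
  simpa using h2 i

/-- If the combination equals an exponent `μ`, independence on `insert μ F` applies to the relation
obtained by moving `μ` to the other side. It supplies the hypothesis `hsupp` of `sum_norm_coeff_le`.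
-/
theorem eq_single_of_sum_mem {Λ : Set ℝ} (hindep : LinearIndependent ℚ (fun μ : Λ => (μ : ℝ)))
    (F : Finset Λ) [DecidableEq F] (q : F → ℤ) (hq : ∑ i, (q i : ℝ) * ((i : Λ) : ℝ) ∈ Λ) :
    ∃ i, q = Pi.single i 1 := by
  classical
  set μ : Λ := ⟨_, hq⟩ with hμ
  set g : Λ → ℤ := fun i => if h : i ∈ F then q ⟨i, h⟩ else 0 with hg
  have hgF : ∀ i : F, g i = q i := fun i => by simp [hg]
  have hsum : ∑ i : ↥(insert μ F), ((g i - if (i : Λ) = μ then 1 else 0 : ℤ) : ℝ) *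
      ((i : Λ) : ℝ) = 0 := by
    rw [Finset.sum_coe_sort (insert μ F)
      (fun i : Λ => ((g i - if i = μ then 1 else 0 : ℤ) : ℝ) * (i : ℝ))]
    simp only [Int.cast_sub, sub_mul, Finset.sum_sub_distrib]
    have h1 : ∑ i ∈ insert μ F, (g i : ℝ) * (i : ℝ) = μ := by
      rw [← Finset.sum_subset (Finset.subset_insert μ F)]
      · rw [← Finset.sum_coe_sort]
        simp only [hgF, hμ]
      · intro i _ hi
        simp [hg, hi]
    rw [h1]
    simp
  have h0 := sum_int_mul_eq_zero hindep (insert μ F)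
    (fun i => g i - if (i : Λ) = μ then 1 else 0) hsum
  have hall : ∀ i ∈ insert μ F, g i = if i = μ then 1 else 0 := fun i hi => by
    have := congrFun h0 ⟨i, hi⟩
    simpa [sub_eq_zero] using this
  have hμF : μ ∈ F := by
    by_contra hcon
    have := hall μ (Finset.mem_insert_self _ _)
    simp [hg, hcon] at this
  refine ⟨⟨μ, hμF⟩, funext fun i => ?_⟩
  rw [← hgF, hall i (Finset.mem_insert_of_mem i.2), Pi.single_apply]
  simp only [Subtype.ext_iff]

/-- Bohr's inequality bounds all finite partial sums by the same `2 * C`. -/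
theorem summable_termSize (hf : AlmostPeriodicInStrip f α β)
    (hindep : LinearIndependent ℚ (fun μ : fourierExponents f α β => (μ : ℝ)))
    {σ : ℝ} (h1 : α < σ) (h2 : (σ : EReal) < β) :
    Summable fun i : fourierExponents f α β => termSize f α β σ i := by
  classical
  obtain ⟨C, -, hC⟩ := (hf.line h1 h2).bounded
  refine summable_of_sum_le (c := 2 * C) (fun i => by unfold termSize; positivity) fun F => ?_
  have := sum_norm_coeff_le (ι := F) (lam := fun i => ((i : fourierExponents f α β) : ℝ))
    (hf.line h1 h2).1 hC (hasMean_line_mul_realChar hf h1 h2) (sum_int_mul_eq_zero hindep F)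
    (fun q hq => eq_single_of_sum_mem hindep F q (left_ne_zero_of_mul hq))
  rw [← Finset.sum_coe_sort]
  refine le_trans (le_of_eq (Finset.sum_congr rfl fun i _ => ?_)) this
  rw [norm_mul, Complex.norm_real, Real.norm_of_nonneg (Real.exp_pos _).le, termSize]

theorem norm_term (f : ℂ → ℂ) (α β : EReal) (μ : ℝ) (s : ℂ) :
    ‖dirichletCoeff f α β μ * Complex.exp (μ * s)‖ = termSize f α β s.re μ := by
  rw [norm_mul, Complex.norm_exp, termSize]
  congr 2
  simp [mul_comm]

/-- The Dirichlet series of an almost periodic function with independent exponents represents the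
function. -/
theorem eq_tsum_dirichlet (hf : AlmostPeriodicInStrip f α β)
    (hindep : LinearIndependent ℚ (fun μ : fourierExponents f α β => (μ : ℝ)))
    {s : ℂ} (hs : s ∈ verticalStrip α β) :
    f s = ∑' i : fourierExponents f α β,
      dirichletCoeff f α β i * Complex.exp (((i : ℝ) : ℂ) * s) := by
  have hsum := summable_termSize hf hindep hs.1 hs.2
  have := (hf.line hs.1 hs.2).eq_tsum_realChar
    (lam := fun i : fourierExponents f α β => (i : ℝ))
    (A := fun i : fourierExponents f α β => dirichletCoeff f α β i * Real.exp (s.re * i))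
    Subtype.val_injective (by
      refine hsum.congr fun i => ?_
      rw [norm_mul, Complex.norm_real, Real.norm_of_nonneg (Real.exp_pos _).le, termSize])
    (a := fun ν => dirichletCoeff f α β ν * Real.exp (s.re * ν)) (fun _ => rfl) (fun ν hν => by
      have : dirichletCoeff f α β ν = 0 := by
        by_contra hne
        exact hν ⟨⟨ν, hne⟩, rfl⟩
      simp [this]) (hasMean_line_mul_realChar hf hs.1 hs.2) s.im
  have hss : (s.re : ℂ) + Complex.I * s.im = s := by rw [mul_comm]; exact Complex.re_add_im s
  rw [hss] at this
  rw [this]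
  refine tsum_congr fun i => ?_
  rw [mul_assoc, realChar, Complex.ofReal_exp, ← Complex.exp_add]
  congr 2
  conv_rhs => rw [← hss]
  push_cast
  ring

end Strip

/-! ### Closing an infinite polygon -/

section Polygon

variable {ι : Type*}

/-- Greedy choice: each new term gets the sign opposite to the current sum, which therefore never
leaves `[-M, M]`. -/
theorem exists_signs_abs_le (W : ι → ℝ) {M : ℝ} (hW : ∀ i, 0 ≤ W i) (hWM : ∀ i, W i ≤ M)
    (F : Finset ι) {x : ℝ} (hx : |x| ≤ M) :
    ∃ e : ι → ℝ, (∀ i, e i = 1 ∨ e i = -1) ∧ |x + ∑ i ∈ F, e i * W i| ≤ M := by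
  classical
  induction F using Finset.induction_on with
  | empty => exact ⟨fun _ => 1, fun _ => Or.inl rfl, by simpa using hx⟩
  | insert a s ha ih =>
    obtain ⟨e, he, hle⟩ := ih
    set y := x + ∑ i ∈ s, e i * W i
    have hcongr : ∀ z : ℝ, x + ∑ i ∈ insert a s, Function.update e a z i * W i = y + z * W a := by
      intro z
      rw [Finset.sum_insert ha, Function.update_self]
      have : ∑ i ∈ s, Function.update e a z i * W i = ∑ i ∈ s, e i * W i :=
        Finset.sum_congr rfl fun i hi => by
          rw [Function.update_of_ne (ne_of_mem_of_not_mem hi ha)]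
      rw [this]
      ring
    have hupd : ∀ z : ℝ, (z = 1 ∨ z = -1) →
        ∀ i, Function.update e a z i = 1 ∨ Function.update e a z i = -1 := by
      intro z hz i
      rcases eq_or_ne i a with rfl | hia
      · simpa using hz
      · simpa [Function.update_of_ne hia] using he i
    have h1 := abs_le.1 hle
    have h2 := hW a
    have h3 := hWM a
    rcases le_total 0 y with hy | hy
    · refine ⟨Function.update e a (-1), hupd _ (Or.inr rfl), ?_⟩
      rw [hcongr, abs_le]
      constructor <;> linarith
    · refine ⟨Function.update e a 1, hupd _ (Or.inl rfl), ?_⟩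
      rw [hcongr, abs_le]
      constructor <;> linarith

theorem exists_max_of_summable [Nonempty ι] {T : ι → ℝ} (hT : ∀ i, 0 < T i) (hs : Summable T) :
    ∃ j, ∀ i, T i ≤ T j := by
  obtain ⟨i₀⟩ := ‹Nonempty ι›
  have hfin : {i | T i₀ ≤ T i}.Finite := by
    have := hs.tendsto_cofinite_zero.eventually (gt_mem_nhds (hT i₀))
    rw [eventually_cofinite] at this
    simpa using this
  obtain ⟨j, hj, hmax⟩ := Set.exists_max_image _ T hfin ⟨i₀, le_refl (T i₀)⟩
  refine ⟨j, fun i => ?_⟩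
  rcases le_total (T i₀) (T i) with h | h
  · exact hmax i h
  · exact h.trans hj

/-- An infinite polygon closes up when no side is longer than all the others together. -/
theorem exists_phases [Nonempty ι] {T : ι → ℝ} (hT : ∀ i, 0 < T i) (hs : Summable T)
    (hle : ∀ j, 2 * T j ≤ ∑' i, T i) :
    ∃ c : ι → ℂ, (∀ i, ‖c i‖ = 1) ∧ HasSum (fun i => (T i : ℂ) * c i) 0 := by
  classical
  obtain ⟨j, hj⟩ := exists_max_of_summable hT hs
  set M := T j with hM
  have hM0 : 0 < M := hT j
  -- The longest side `j` is set aside. The others must be turned so that their sum has modulus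
  -- exactly `M`; side `j` then closes the polygon.
  set W : ι → ℝ := Function.update T j 0 with hWdef
  have hWs : HasSum W (0 - M + ∑' i, T i) := hs.hasSum.update j 0
  have hW0 : ∀ i, 0 ≤ W i := fun i => by
    rcases eq_or_ne i j with rfl | h
    · simp [hWdef]
    · simpa [hWdef, Function.update_of_ne h] using (hT i).le
  have hWM : ∀ i, W i ≤ M := fun i => by
    rcases eq_or_ne i j with rfl | h
    · simpa [hWdef] using hM0.le
    · simpa [hWdef, Function.update_of_ne h] using hj i
  have hWsum : M ≤ ∑' i, W i := by
    rw [hWs.tsum_eq]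
    linarith [hle j]
  obtain ⟨F, hF⟩ := exists_finset_norm_tsum_sub_le hWs.summable hM0
  have htail := hF F subset_rfl (fun i => (W i : ℂ)) (fun i => by
    rw [Complex.norm_real, Real.norm_of_nonneg (hW0 i)])
  rw [← Complex.ofReal_tsum, ← Complex.ofReal_sum, ← Complex.ofReal_sub, Complex.norm_real,
    Real.norm_eq_abs] at htail
  -- The greedy signs start from the tail outside `F`, already at most `M`, so finitely many signs
  -- suffice.
  obtain ⟨e₀, he₀, hsum₀⟩ := exists_signs_abs_le W hW0 hWM F htail
  set e : ι → ℝ := fun i => if i ∈ F then e₀ i else 1 with he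
  have he1 : ∀ i, e i = 1 ∨ e i = -1 := fun i => by
    by_cases h : i ∈ F
    · simpa [he, h] using he₀ i
    · simp [he, h]
  have heabs : ∀ i, |e i| = 1 := fun i => by rcases he1 i with h | h <;> simp [h]
  have hWe : Summable fun i => e i * W i := by
    refine Summable.of_norm_bounded hWs.summable fun i => ?_
    rw [norm_mul, Real.norm_eq_abs, heabs, one_mul, Real.norm_of_nonneg (hW0 i)]
  have hesum : |∑' i, e i * W i| ≤ M := by
    have h1 := hWe.sum_add_tsum_subtype_compl F
    have h2 := hWs.summable.sum_add_tsum_subtype_compl F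
    have h3 : ∑ i ∈ F, e i * W i = ∑ i ∈ F, e₀ i * W i :=
      Finset.sum_congr rfl fun i hi => by simp [he, hi]
    have h4 : ∑' i : {i // i ∉ F}, e i * W i = ∑' i : {i // i ∉ F}, W i :=
      tsum_congr fun i => by simp [he, i.2]
    rw [← h1, h3, h4]
    rw [← h2, add_sub_cancel_left] at hsum₀
    rwa [add_comm]
  set X := ∑' i, W i
  set Y := ∑' i, e i * W i
  -- The sides with sign `-1` turn together by the angle `θ`. The sum goes from `X ≥ M` at `θ = 0`
  -- to `Y` with `|Y| ≤ M` at `θ = π`, so its modulus takes the value `M`.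
  have hφ : Continuous fun θ : ℝ => ‖(((X + Y) / 2 : ℝ) : ℂ) + (((X - Y) / 2 : ℝ) : ℂ) *
      realChar 1 θ‖ := by
    have := continuous_realChar 1
    fun_prop
  obtain ⟨θ, hθ⟩ := mem_range_of_exists_le_of_exists_ge (c := M) hφ
    ⟨Real.pi, by
      have : realChar 1 Real.pi = -1 := by
        rw [realChar, one_mul, mul_comm, Complex.exp_pi_mul_I]
      simp only [this]
      have h5 : (((X + Y) / 2 : ℝ) : ℂ) + (((X - Y) / 2 : ℝ) : ℂ) * -1 = (Y : ℂ) := by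
        push_cast
        ring
      rw [h5, Complex.norm_real]
      exact hesum⟩
    ⟨0, by
      rw [realChar_zero_right]
      have h5 : (((X + Y) / 2 : ℝ) : ℂ) + (((X - Y) / 2 : ℝ) : ℂ) * 1 = (X : ℂ) := by
        push_cast
        ring
      rw [h5, Complex.norm_real]
      exact hWsum.trans (le_abs_self _)⟩
  simp only at hθ
  set z := realChar 1 θ
  set w := (((X + Y) / 2 : ℝ) : ℂ) + (((X - Y) / 2 : ℝ) : ℂ) * z with hw
  have hMc : (M : ℂ) ≠ 0 := by exact_mod_cast hM0.ne'
  set d : ι → ℂ := fun i => ((1 + e i) / 2 : ℂ) + ((1 - e i) / 2 : ℂ) * z with hd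
  have hd1 : ∀ i, ‖d i‖ = 1 := fun i => by
    rcases he1 i with h | h
    · simp [hd, h]
    · simp [hd, h, z, norm_realChar]
  have hdsum : HasSum (fun i => (W i : ℂ) * d i) w := by
    have h6 := Complex.hasSum_ofReal.2 hWs.summable.hasSum
    have h7 := Complex.hasSum_ofReal.2 hWe.hasSum
    have h8 := (h6.mul_left ((1 + z) / 2)).add (h7.mul_left ((1 - z) / 2))
    have hfun : (fun i => (W i : ℂ) * d i) =
        fun i => (1 + z) / 2 * (W i : ℂ) + (1 - z) / 2 * ((e i * W i : ℝ) : ℂ) := by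
      funext i
      simp only [hd]
      push_cast
      ring
    have hval : w = (1 + z) / 2 * (X : ℂ) + (1 - z) / 2 * (Y : ℂ) := by
      simp only [hw]
      push_cast
      ring
    rw [hfun, hval]
    exact h8
  refine ⟨Function.update d j (-w / M), fun i => ?_, ?_⟩
  · rcases eq_or_ne i j with rfl | h
    · rw [Function.update_self, norm_div, norm_neg, hθ, Complex.norm_real,
        Real.norm_of_nonneg hM0.le, div_self hM0.ne']
    · rw [Function.update_of_ne h]
      exact hd1 i
  · have h9 := hdsum.update j (-w)
    have h10 : (W j : ℂ) * d j = 0 := by simp [hWdef]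
    have hfun : (fun i => (T i : ℂ) * Function.update d j (-w / M) i) =
        Function.update (fun i => (W i : ℂ) * d i) j (-w) := by
      funext i
      rcases eq_or_ne i j with rfl | h
      · rw [Function.update_self, Function.update_self, ← hM]
        field_simp
      · rw [Function.update_of_ne h, Function.update_of_ne h, hWdef, Function.update_of_ne h]
    rw [h10, sub_zero, neg_add_cancel] at h9
    rw [hfun]
    exact h9

end Polygon

/-! ### Zeros of `f` and the polygon inequalities -/

/-- A form of Hurwitz's theorem. -/
theorem exists_zero_of_close {F G : ℂ → ℂ} {z₀ : ℂ} {r m : ℝ} (hr : 0 < r) (hm : 0 < m)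
    (hF0 : F z₀ = 0) (hFm : ∀ z ∈ Metric.sphere z₀ r, m ≤ ‖F z‖)
    (hG : DifferentiableOn ℂ G (Metric.closedBall z₀ r))
    (hclose : ∀ z ∈ Metric.closedBall z₀ r, ‖G z - F z‖ ≤ m / 4) :
    ∃ z ∈ Metric.closedBall z₀ r, G z = 0 := by
  by_contra! hne
  have hcl : closure (Metric.ball z₀ r) = Metric.closedBall z₀ r := closure_ball z₀ hr.ne'
  have hGd : DiffContOnCl ℂ G (Metric.ball z₀ r) := by
    rw [← hcl] at hG
    exact hG.diffContOnCl
  have hinv : DiffContOnCl ℂ G⁻¹ (Metric.ball z₀ r) := hGd.inv (by rwa [hcl])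
  -- Maximum principle for `1 / G`: on the sphere `|G| ≥ m / 2`, hence also at the centre, where
  -- however `|G| ≤ m / 4`.
  have hbound := Complex.norm_le_of_forall_mem_frontier_norm_le (z := z₀) (C := (m / 2)⁻¹)
    Metric.isBounded_ball hinv (fun z hz => by
      rw [frontier_ball z₀ hr.ne'] at hz
      have h1 := hclose z (Metric.sphere_subset_closedBall hz)
      have h2 := hFm z hz
      have h3 := norm_sub_le (G z) (G z - F z)
      rw [sub_sub_cancel] at h3
      rw [Pi.inv_apply, norm_inv]
      gcongr
      linarith) (by rw [hcl]; exact Metric.mem_closedBall_self hr.le)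
  have hz := Metric.mem_closedBall_self (x := z₀) hr.le
  have h4 := hclose z₀ hz
  rw [hF0, sub_zero] at h4
  have h5 : 0 < ‖G z₀‖ := norm_pos_iff.2 (hne z₀ hz)
  rw [Pi.inv_apply, norm_inv, inv_le_inv₀ h5 (by positivity)] at hbound
  linarith

section Main

variable {α β : EReal} {f : ℂ → ℂ}

theorem termSize_pos {σ : ℝ} (i : fourierExponents f α β) : 0 < termSize f α β σ i :=
  mul_pos (norm_pos_iff.2 i.2) (Real.exp_pos _)

/-- Provides a summable majorant of the terms that is uniform over `[a, b]`. -/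
theorem termSize_le_add {a b σ : ℝ} (h1 : a ≤ σ) (h2 : σ ≤ b) (μ : ℝ) :
    termSize f α β σ μ ≤ termSize f α β a μ + termSize f α β b μ := by
  unfold termSize
  rw [← mul_add]
  gcongr
  rcases le_total 0 μ with h | h
  · have : Real.exp (σ * μ) ≤ Real.exp (b * μ) := by gcongr
    linarith [Real.exp_pos (a * μ)]
  · have : Real.exp (σ * μ) ≤ Real.exp (a * μ) :=
      Real.exp_le_exp.2 (mul_le_mul_of_nonpos_right h1 h)
    linarith [Real.exp_pos (b * μ)]

theorem continuous_termSize (μ : ℝ) : Continuous fun σ => termSize f α β σ μ := by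
  unfold termSize
  fun_prop

/-- Vertical translates of `f` come arbitrarily close to every function obtained by turning the
coefficients of its Dirichlet series. -/
theorem exists_translate_near (hf : AlmostPeriodicInStrip f α β)
    (hindep : LinearIndependent ℚ (fun μ : fourierExponents f α β => (μ : ℝ)))
    {a b : ℝ} (ha : α < a) (hab : a ≤ b) (hb : (b : EReal) < β)
    {d : fourierExponents f α β → ℂ} (hd : ∀ i, ‖d i‖ = 1) {δ : ℝ} (hδ : 0 < δ) :
    ∃ τ : ℝ, ∀ s : ℂ, a ≤ s.re → s.re ≤ b → ‖f (s + Complex.I * τ) -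
      ∑' i : fourierExponents f α β,
        dirichletCoeff f α β i * d i * Complex.exp (((i : ℝ) : ℂ) * s)‖ ≤ δ := by
  classical
  set D : fourierExponents f α β → ℝ := fun i => termSize f α β a i + termSize f α β b i
  have hD : Summable D := (summable_termSize hf hindep ha
    ((EReal.coe_le_coe_iff.2 hab).trans_lt hb)).add
    (summable_termSize hf hindep (ha.trans_le (EReal.coe_le_coe_iff.2 hab)) hb)
  have hD0 : ∀ i, 0 ≤ D i := fun i => (add_pos (termSize_pos i) (termSize_pos i)).le
  -- Outside `F` the phases are uncontrolled, and only `|realChar i τ - d i| ≤ 2` is available; this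
  -- is the factor `2`.
  obtain ⟨F, hF⟩ := exists_finset_norm_tsum_sub_le (hD.mul_left 2) (half_pos hδ)
  have hDF : 0 ≤ ∑ i ∈ F, D i := Finset.sum_nonneg fun i _ => hD0 i
  obtain ⟨τ, hτ⟩ := exists_realChar_near (ι := F) (c := fun i => d i)
    (sum_int_mul_eq_zero hindep F) (fun i => hd i)
    (ε := δ / (2 * (∑ i ∈ F, D i + 1))) (by positivity)
  refine ⟨τ, fun s h1 h2 => ?_⟩
  have hsD : ∀ i : fourierExponents f α β,
      ‖dirichletCoeff f α β i * Complex.exp (((i : ℝ) : ℂ) * s)‖ ≤ D i := fun i => by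
    rw [norm_term]
    exact termSize_le_add h1 h2 _
  have hs : s + Complex.I * τ ∈ verticalStrip α β :=
    mem_verticalStrip_of_re ha hb (by simpa using h1) (by simpa using h2)
  have hexp : ∀ i : fourierExponents f α β,
      dirichletCoeff f α β i * Complex.exp (((i : ℝ) : ℂ) * (s + Complex.I * τ)) =
      dirichletCoeff f α β i * Complex.exp (((i : ℝ) : ℂ) * s) * realChar i τ := fun i => by
    rw [realChar, mul_assoc, ← Complex.exp_add]
    congr 2
    push_cast
    ring
  rw [eq_tsum_dirichlet hf hindep hs]
  simp only [hexp]
  have hs1 : Summable fun i : fourierExponents f α β =>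
      dirichletCoeff f α β i * Complex.exp (((i : ℝ) : ℂ) * s) * realChar i τ :=
    Summable.of_norm_bounded hD fun i => by
      rw [norm_mul, norm_realChar, mul_one]
      exact hsD i
  have hs2 : Summable fun i : fourierExponents f α β =>
      dirichletCoeff f α β i * d i * Complex.exp (((i : ℝ) : ℂ) * s) :=
    Summable.of_norm_bounded hD fun i => by
      rw [mul_right_comm, norm_mul, hd, mul_one]
      exact hsD i
  rw [← hs1.tsum_sub hs2]
  have hrw : ∀ i : fourierExponents f α β,
      dirichletCoeff f α β i * Complex.exp (((i : ℝ) : ℂ) * s) * realChar i τ -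
      dirichletCoeff f α β i * d i * Complex.exp (((i : ℝ) : ℂ) * s) =
      dirichletCoeff f α β i * Complex.exp (((i : ℝ) : ℂ) * s) * (realChar i τ - d i) :=
    fun i => by ring
  simp only [hrw]
  have e1 := hF F subset_rfl (fun i : fourierExponents f α β =>
      dirichletCoeff f α β i * Complex.exp (((i : ℝ) : ℂ) * s) * (realChar i τ - d i)) (fun i => by
    rw [norm_mul, mul_comm 2]
    have := norm_sub_le (realChar i τ) (d i)
    rw [norm_realChar, hd] at this
    have h0 := hD0 i
    gcongr
    · exact hsD i
    · linarith)
  have e2 : ‖∑ i ∈ F, dirichletCoeff f α β i * Complex.exp (((i : ℝ) : ℂ) * s) *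
      (realChar i τ - d i)‖ ≤ δ / 2 := by
    calc _ ≤ ∑ i ∈ F, D i * (δ / (2 * (∑ i ∈ F, D i + 1))) := by
          refine norm_sum_le_of_le _ fun i hi => ?_
          rw [norm_mul]
          have h0 := hD0 i
          gcongr
          · exact hsD i
          · exact hτ ⟨i, hi⟩
      _ = (∑ i ∈ F, D i) / (∑ i ∈ F, D i + 1) * (δ / 2) := by
          rw [← Finset.sum_mul]
          field_simp
      _ ≤ 1 * (δ / 2) := by
          gcongr
          exact (div_le_one (by positivity)).2 (by linarith)
      _ = δ / 2 := one_mul _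
  have e3 := norm_add_le ((∑' i : fourierExponents f α β, dirichletCoeff f α β i *
    Complex.exp (((i : ℝ) : ℂ) * s) * (realChar i τ - d i)) - ∑ i ∈ F, dirichletCoeff f α β i *
    Complex.exp (((i : ℝ) : ℂ) * s) * (realChar i τ - d i)) (∑ i ∈ F, dirichletCoeff f α β i *
    Complex.exp (((i : ℝ) : ℂ) * s) * (realChar i τ - d i))
  rw [sub_add_cancel] at e3
  linarith

theorem exists_real_btwn_strip {σ : ℝ} (h1 : α < σ) (h2 : (σ : EReal) < β) :
    ∃ a b : ℝ, α < a ∧ a < σ ∧ σ < b ∧ (b : EReal) < β := by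
  obtain ⟨a, ha1, ha2⟩ := EReal.lt_iff_exists_real_btwn.1 h1
  obtain ⟨b, hb1, hb2⟩ := EReal.lt_iff_exists_real_btwn.1 h2
  exact ⟨a, b, ha1, EReal.coe_lt_coe_iff.1 ha2, EReal.coe_lt_coe_iff.1 hb1, hb2⟩

theorem mem_closure_zeros_of_le (hf : AlmostPeriodicInStrip f α β)
    (hindep : LinearIndependent ℚ (fun μ : fourierExponents f α β => (μ : ℝ)))
    [Nonempty (fourierExponents f α β)] {σ : ℝ} (h1 : α < σ) (h2 : (σ : EReal) < β)
    (hle : ∀ j : fourierExponents f α β, 2 * termSize f α β σ j ≤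
      ∑' i : fourierExponents f α β, termSize f α β σ i) :
    σ ∈ closure {σ : ℝ | ∃ s ∈ verticalStrip α β, f s = 0 ∧ s.re = σ} := by
  classical
  have hsum := summable_termSize hf hindep h1 h2
  obtain ⟨c, hc1, hc⟩ := exists_phases (fun i => termSize_pos i) hsum hle
  obtain ⟨a, b, ha, haσ, hσb, hb⟩ := exists_real_btwn_strip h1 h2
  have hab : a ≤ b := (haσ.trans hσb).le
  -- Chosen so that the coefficient times `d i` is its modulus times `c i`; the turned series then
  -- has the closing polygon as its terms at `σ`.
  set d : fourierExponents f α β → ℂ := fun i =>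
    c i * (‖dirichletCoeff f α β i‖ / dirichletCoeff f α β i) with hd
  have hd1 : ∀ i, ‖d i‖ = 1 := fun i => by
    have h0 : ‖dirichletCoeff f α β i‖ ≠ 0 := norm_ne_zero_iff.2 i.2
    simp [hd, hc1, h0]
  set F : ℂ → ℂ := fun s => ∑' i : fourierExponents f α β,
    dirichletCoeff f α β i * d i * Complex.exp (((i : ℝ) : ℂ) * s) with hF
  have hline : ∀ t : ℝ, F (σ + Complex.I * t) =
      ∑' i : fourierExponents f α β, (termSize f α β σ i : ℂ) * c i * realChar i t := by
    intro t
    simp only [hF]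
    refine tsum_congr fun i => ?_
    have h0 : dirichletCoeff f α β i ≠ 0 := i.2
    have h3 : Complex.exp (((i : ℝ) : ℂ) * (σ + Complex.I * t)) =
        Real.exp (σ * i) * realChar i t := by
      rw [realChar, Complex.ofReal_exp, ← Complex.exp_add]
      congr 1
      push_cast
      ring
    rw [h3, termSize, hd]
    push_cast
    field_simp
  have hF0 : F σ = 0 := by
    have := hline 0
    simp only [Complex.ofReal_zero, mul_zero, add_zero, realChar_zero_right, mul_one] at this
    rw [this, hc.tsum_eq]
  set U := verticalStrip (a : EReal) (b : EReal) with hU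
  have hUo : IsOpen U := isOpen_verticalStrip _ _
  have hUmem : ∀ s, s ∈ U ↔ a < s.re ∧ s.re < b := fun s => by
    simp [hU, verticalStrip]
  have hFd : DifferentiableOn ℂ F U := by
    refine Complex.differentiableOn_tsum_of_summable_norm
      (u := fun i : fourierExponents f α β => termSize f α β a i + termSize f α β b i)
      ((summable_termSize hf hindep ha ((EReal.coe_lt_coe_iff.2 haσ).trans h2)).add
        (summable_termSize hf hindep (h1.trans (EReal.coe_lt_coe_iff.2 hσb)) hb))
      (fun i => ?_) hUo (fun i w hw => ?_)
    · exact ((differentiable_const _).mul (Differentiable.cexp (by fun_prop))).differentiableOn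
    · rw [hUmem] at hw
      rw [mul_right_comm, norm_mul, hd1, mul_one, norm_term]
      exact termSize_le_add hw.1.le hw.2.le _
  have hFa : AnalyticOnNhd ℂ F U := hFd.analyticOnNhd hUo
  have hσU : (σ : ℂ) ∈ U := (hUmem _).2 ⟨by simpa using haσ, by simpa using hσb⟩
  have hUconn : IsPreconnected U := by
    have : U = Complex.reLm ⁻¹' Set.Ioo a b := by
      ext s
      rw [hUmem]
      rfl
    rw [this]
    exact ((convex_Ioo a b).linear_preimage Complex.reLm).isPreconnected
  -- Hurwitz's theorem needs an isolated zero. If `F` vanished identically, so would its mean values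
  -- on the line through `σ`, whose moduli are the positive term sizes.
  have hne : ∀ᶠ z in 𝓝[≠] (σ : ℂ), F z ≠ 0 := by
    rcases (hFa _ hσU).eventually_eq_zero_or_eventually_ne_zero with h | h
    · exfalso
      have hzero := hFa.eqOn_zero_of_preconnected_of_eventuallyEq_zero hUconn hσU h
      obtain ⟨j⟩ := ‹Nonempty (fourierExponents f α β)›
      have hm := hasMean_tsum_realChar
        (lam := fun i : fourierExponents f α β => (i : ℝ))
        (A := fun i => (termSize f α β σ i : ℂ) * c i) Subtype.val_injective
        (by
          refine hsum.congr fun i => ?_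
          rw [norm_mul, hc1, mul_one, Complex.norm_real, Real.norm_of_nonneg (termSize_pos i).le])
        (a := fun ν => if h : ν ∈ fourierExponents f α β then
          (termSize f α β σ ν : ℂ) * c ⟨ν, h⟩ else 0)
        (fun i => by simp)
        (fun ν hν => by
          rw [dif_neg]
          exact fun h => hν ⟨⟨ν, h⟩, rfl⟩) j
      have hz : ∀ t : ℝ, (∑' i : fourierExponents f α β,
          (termSize f α β σ i : ℂ) * c i * realChar i t) = 0 := fun t => by
        rw [← hline]
        exact hzero ((hUmem _).2 (by rw [re_line]; exact ⟨haσ, hσb⟩))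
      simp only [hz, zero_mul, Subtype.coe_prop, dif_pos] at hm
      have := HasMean.unique hm HasMean.zero
      have h3 : ‖(termSize f α β σ j : ℂ) * c j‖ = 0 := by rw [this, norm_zero]
      rw [norm_mul, hc1, mul_one, Complex.norm_real, Real.norm_of_nonneg (termSize_pos j).le] at h3
      exact (termSize_pos j).ne' h3
    · exact h
  rw [Metric.mem_closure_iff]
  intro ε hε
  rw [eventually_nhdsWithin_iff, Metric.eventually_nhds_iff] at hne
  obtain ⟨ρ, hρ, hρne⟩ := hne
  set r := min (min ε ρ) (min (σ - a) (b - σ)) / 2 with hr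
  have hr0 : 0 < r := by
    have : 0 < σ - a := by linarith
    have : 0 < b - σ := by linarith
    positivity
  have hrall : r < min (min ε ρ) (min (σ - a) (b - σ)) := half_lt_self (by linarith)
  simp only [lt_min_iff] at hrall
  obtain ⟨⟨hrε, hrρ⟩, hra, hrb⟩ := hrall
  have hre : ∀ z ∈ Metric.closedBall (σ : ℂ) r, |z.re - σ| ≤ r := fun z hz => by
    rw [Metric.mem_closedBall, dist_eq_norm] at hz
    have := Complex.abs_re_le_norm (z - σ)
    simp only [Complex.sub_re, Complex.ofReal_re] at this
    exact this.trans hz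
  have hballU : ∀ z ∈ Metric.closedBall (σ : ℂ) r, a ≤ z.re ∧ z.re ≤ b := fun z hz => by
    have := abs_le.1 (hre z hz)
    exact ⟨by linarith, by linarith⟩
  have hballU' : Metric.closedBall (σ : ℂ) r ⊆ U := fun z hz => by
    have := abs_le.1 (hre z hz)
    exact (hUmem z).2 ⟨by linarith, by linarith⟩
  obtain ⟨z₁, hz₁, hmin⟩ := (isCompact_sphere (σ : ℂ) r).exists_isMinOn
    (NormedSpace.sphere_nonempty.2 hr0.le)
    ((hFd.continuousOn.mono (Metric.sphere_subset_closedBall.trans hballU')).norm)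
  have hz₁F : F z₁ ≠ 0 := by
    rw [Metric.mem_sphere] at hz₁
    refine hρne (by linarith) ?_
    simp only [Set.mem_compl_iff, Set.mem_singleton_iff]
    rintro rfl
    rw [dist_self] at hz₁
    linarith
  have hm0 : 0 < ‖F z₁‖ := norm_pos_iff.2 hz₁F
  obtain ⟨τ, hτ⟩ := exists_translate_near hf hindep ha hab hb hd1
    (δ := ‖F z₁‖ / 4) (by positivity)
  obtain ⟨z, hz, hGz⟩ := exists_zero_of_close (G := fun z => f (z + Complex.I * τ)) hr0 hm0 hF0
    (fun z hz => hmin hz) (by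
      refine hf.1.comp (by fun_prop) fun z hz => ?_
      exact mem_verticalStrip_of_re ha hb (by simpa using (hballU z hz).1)
        (by simpa using (hballU z hz).2))
    (fun z hz => hτ z (hballU z hz).1 (hballU z hz).2)
  refine ⟨z.re, ⟨z + Complex.I * τ, ?_, hGz, by simp⟩, ?_⟩
  · exact mem_verticalStrip_of_re ha hb (by simpa using (hballU z hz).1)
        (by simpa using (hballU z hz).2)
  · rw [dist_comm, Real.dist_eq]
    exact (hre z hz).trans_lt hrε

theorem continuousAt_tsum_termSize (hf : AlmostPeriodicInStrip f α β)
    (hindep : LinearIndependent ℚ (fun μ : fourierExponents f α β => (μ : ℝ)))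
    {σ : ℝ} (h1 : α < σ) (h2 : (σ : EReal) < β) :
    ContinuousAt (fun σ => ∑' i : fourierExponents f α β, termSize f α β σ i) σ := by
  obtain ⟨a, b, ha, haσ, hσb, hb⟩ := exists_real_btwn_strip h1 h2
  have : ContinuousOn (fun σ => ∑' i : fourierExponents f α β, termSize f α β σ i)
      (Set.Icc a b) := by
    refine continuousOn_tsum
      (u := fun i : fourierExponents f α β => termSize f α β a i + termSize f α β b i)
      (fun i => (continuous_termSize _).continuousOn)
      ((summable_termSize hf hindep ha ((EReal.coe_lt_coe_iff.2 haσ).trans h2)).add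
        (summable_termSize hf hindep (h1.trans (EReal.coe_lt_coe_iff.2 hσb)) hb))
      (fun i x hx => ?_)
    rw [Real.norm_of_nonneg (termSize_pos i).le]
    exact termSize_le_add hx.1 hx.2 _
  exact this.continuousAt (Icc_mem_nhds haσ hσb)

/-- At a zero each term of the series is minus the sum of the others. -/
theorem two_mul_termSize_le_of_zero (hf : AlmostPeriodicInStrip f α β)
    (hindep : LinearIndependent ℚ (fun μ : fourierExponents f α β => (μ : ℝ)))
    {s : ℂ} (hs : s ∈ verticalStrip α β) (h0 : f s = 0) (j : fourierExponents f α β) :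
    2 * termSize f α β s.re j ≤ ∑' i : fourierExponents f α β, termSize f α β s.re i := by
  classical
  have hsum := summable_termSize hf hindep hs.1 hs.2
  have hs' : Summable fun i : fourierExponents f α β =>
      dirichletCoeff f α β i * Complex.exp (((i : ℝ) : ℂ) * s) :=
    Summable.of_norm (hsum.congr fun i => (norm_term f α β i s).symm)
  have e1 := hs'.sum_add_tsum_subtype_compl {j}
  have e2 := hsum.sum_add_tsum_subtype_compl {j}
  rw [← eq_tsum_dirichlet hf hindep hs, h0, Finset.sum_singleton] at e1
  rw [Finset.sum_singleton] at e2
  have e3 : termSize f α β s.re j ≤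
      ∑' i : {i // i ∉ ({j} : Finset (fourierExponents f α β))}, termSize f α β s.re i := by
    rw [← norm_term, eq_neg_of_add_eq_zero_left e1, norm_neg]
    refine (norm_tsum_le_tsum_norm ?_).trans (le_of_eq ?_)
    · exact (hsum.subtype _).congr fun i => (norm_term f α β _ s).symm
    · exact tsum_congr fun i => norm_term f α β _ s
  linarith

theorem two_mul_termSize_le_of_mem_closure (hf : AlmostPeriodicInStrip f α β)
    (hindep : LinearIndependent ℚ (fun μ : fourierExponents f α β => (μ : ℝ)))
    {σ : ℝ} (h1 : α < σ) (h2 : (σ : EReal) < β)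
    (hσ : σ ∈ closure {σ : ℝ | ∃ s ∈ verticalStrip α β, f s = 0 ∧ s.re = σ})
    (j : fourierExponents f α β) :
    2 * termSize f α β σ j ≤ ∑' i : fourierExponents f α β, termSize f α β σ i := by
  by_contra! hlt
  have hev := (continuousAt_tsum_termSize hf hindep h1 h2).eventually_lt
    ((continuous_const.mul (continuous_termSize (j : ℝ))).continuousAt) hlt
  obtain ⟨σ', ⟨s, hs, h0, rfl⟩, hσ'⟩ := ((mem_closure_iff_frequently.1 hσ).and_eventually hev).exists
  have := two_mul_termSize_le_of_zero hf hindep hs h0 j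
  change _ < 2 * termSize f α β s.re j at hσ'
  linarith

/-- Infinitely many strict inequalities need not persist nearby. Here all but finitely many terms
stay below a quarter of the sum `S σ` throughout `[a, b]`, where `2 * termSize` is less than `S σ /
2 < S x`; continuity takes care of the rest. -/
theorem eventually_two_mul_termSize_le (hf : AlmostPeriodicInStrip f α β)
    (hindep : LinearIndependent ℚ (fun μ : fourierExponents f α β => (μ : ℝ)))
    [Nonempty (fourierExponents f α β)] {σ : ℝ} (h1 : α < σ) (h2 : (σ : EReal) < β)
    (hlt : ∀ j : fourierExponents f α β, 2 * termSize f α β σ j <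
      ∑' i : fourierExponents f α β, termSize f α β σ i) :
    ∀ᶠ x in 𝓝 σ, ∀ j : fourierExponents f α β, 2 * termSize f α β x j ≤
      ∑' i : fourierExponents f α β, termSize f α β x i := by
  obtain ⟨a, b, ha, haσ, hσb, hb⟩ := exists_real_btwn_strip h1 h2
  set S : ℝ → ℝ := fun x => ∑' i : fourierExponents f α β, termSize f α β x i
  have hS : ContinuousAt S σ := continuousAt_tsum_termSize hf hindep h1 h2
  have hS0 : 0 < S σ := by
    obtain ⟨j⟩ := ‹Nonempty (fourierExponents f α β)›
    have := termSize_pos (σ := σ) j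
    have := hlt j
    simp only [S]
    linarith
  have hD : Summable fun i : fourierExponents f α β => termSize f α β a i + termSize f α β b i :=
    (summable_termSize hf hindep ha ((EReal.coe_lt_coe_iff.2 haσ).trans h2)).add
        (summable_termSize hf hindep (h1.trans (EReal.coe_lt_coe_iff.2 hσb)) hb)
  have hfin : {i : fourierExponents f α β |
      S σ / 4 ≤ termSize f α β a i + termSize f α β b i}.Finite := by
    have := hD.tendsto_cofinite_zero.eventually (gt_mem_nhds (by positivity : 0 < S σ / 4))
    rw [eventually_cofinite] at this
    simpa using this
  have e1 : ∀ᶠ x in 𝓝 σ, ∀ j ∈ {i : fourierExponents f α β |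
      S σ / 4 ≤ termSize f α β a i + termSize f α β b i}, 2 * termSize f α β x j < S x := by
    rw [eventually_all_finite hfin]
    exact fun j _ => ((continuous_const.mul (continuous_termSize (j : ℝ))).continuousAt).eventually_lt
      hS (hlt j)
  have e2 : ∀ᶠ x in 𝓝 σ, S σ / 2 < S x := hS.eventually (lt_mem_nhds (half_lt_self hS0))
  filter_upwards [e1, e2, Icc_mem_nhds haσ hσb] with x hx1 hx2 hx3 j
  by_cases hj : S σ / 4 ≤ termSize f α β a j + termSize f α β b j
  · exact (hx1 j hj).le
  · have := termSize_le_add (f := f) (α := α) (β := β) hx3.1 hx3.2 (j : ℝ)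
    change _ ≤ S x
    linarith

end Main

theorem mainTheorem5 (α β : EReal) (f : ℂ → ℂ)
    (hf : AlmostPeriodicInStrip f α β)
    (hcard : 3 ≤ (fourierExponents f α β).encard)
    (hindep : LinearIndependent ℚ (fun μ : fourierExponents f α β => (μ : ℝ)))
    (σ₀ : ℝ) (hα : α < (σ₀ : EReal)) (hβ : (σ₀ : EReal) < β)
    (hσ₀ : σ₀ ∈ frontier (zeroProjections f α β)) :
    Summable (fun i : fourierExponents f α β => termSize f α β σ₀ i) ∧
    (∀ j : fourierExponents f α β,
      termSize f α β σ₀ j ≤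
        ∑' i : {i : fourierExponents f α β // i ≠ j}, termSize f α β σ₀ i) ∧
    (∃! j : fourierExponents f α β,
      termSize f α β σ₀ j =
        ∑' i : {i : fourierExponents f α β // i ≠ j}, termSize f α β σ₀ i) := by
  classical
  have hsum := summable_termSize hf hindep hα hβ
  have hne : Nonempty (fourierExponents f α β) := by
    rw [Set.nonempty_coe_sort, ← Set.encard_pos]
    exact lt_of_lt_of_le (by norm_num) hcard
  have hsplit : ∀ j : fourierExponents f α β,
      ∑' i : {i : fourierExponents f α β // i ≠ j}, termSize f α β σ₀ i =
        (∑' i : fourierExponents f α β, termSize f α β σ₀ i) - termSize f α β σ₀ j := by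
    intro j
    have := hsum.tsum_subtype_add_tsum_subtype_compl {j}
    rw [tsum_singleton j (fun i : fourierExponents f α β => termSize f α β σ₀ i)] at this
    exact eq_sub_of_add_eq' this
  have hmem := closure_mono Set.inter_subset_left (frontier_subset_closure hσ₀)
  rw [closure_closure] at hmem
  have hle := two_mul_termSize_le_of_mem_closure hf hindep hα hβ hmem
  refine ⟨hsum, fun j => by rw [hsplit]; linarith [hle j], ?_⟩
  -- Without an equality the inequalities would hold on a neighbourhood of `σ₀`, which would then
  -- lie in `zeroProjections`, making `σ₀` an interior point.
  obtain ⟨j, hj⟩ : ∃ j : fourierExponents f α β,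
      2 * termSize f α β σ₀ j = ∑' i : fourierExponents f α β, termSize f α β σ₀ i := by
    by_contra! hcon
    have hlt := fun j => lt_of_le_of_ne (hle j) (hcon j)
    obtain ⟨a, b, ha, haσ, hσb, hb⟩ := exists_real_btwn_strip hα hβ
    refine hσ₀.2 (mem_interior_iff_mem_nhds.2 ?_)
    filter_upwards [eventually_two_mul_termSize_le hf hindep hα hβ hlt, Icc_mem_nhds haσ hσb]
      with x hx hxab
    have hx1 : α < (x : EReal) := ha.trans_le (EReal.coe_le_coe_iff.2 hxab.1)
    have hx2 : (x : EReal) < β := (EReal.coe_le_coe_iff.2 hxab.2).trans_lt hb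
    exact ⟨mem_closure_zeros_of_le hf hindep hx1 hx2 hx, hx1, hx2⟩
  refine ⟨j, by simp only [hsplit]; linarith, fun k hk => ?_⟩
  simp only [hsplit] at hk
  by_contra hkj
  -- Equality at both `j` and `k` makes each of these terms half of the whole sum, so a third,
  -- positive term cannot fit.
  obtain ⟨l, hlj, hlk⟩ : ∃ l : fourierExponents f α β, l ≠ j ∧ l ≠ k := by
    by_contra! hcon
    have hsub : fourierExponents f α β ⊆ {(j : ℝ), (k : ℝ)} := fun x hx => by
      by_cases h : (⟨x, hx⟩ : fourierExponents f α β) = j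
      · left
        rw [← h]
      · right
        rw [← hcon ⟨x, hx⟩ h]
        rfl
    have := (hcard.trans (Set.encard_le_encard hsub)).trans (Set.encard_insert_le _ _)
    rw [Set.encard_singleton, one_add_one_eq_two] at this
    exact absurd this (by norm_num)
  have h3 := hsum.sum_le_tsum {j, k, l} fun i _ => (termSize_pos i).le
  rw [Finset.sum_insert (by simp [Ne.symm hkj, Ne.symm hlj]), Finset.sum_pair hlk.symm] at h3
  have := termSize_pos (σ := σ₀) l
  linarith
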